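/- Let $n,m\in\mathbb N$ and $H\in\mathbb R^{m\times n}$, let $\hat\mu_x\in\mathbb R^n$, $\hat\mu_w\in\mathbb R^m$, let $\hat\Sigma_x\in\mathbb R^{n\times n}$, $\hat\Sigma_w\in\mathbb R^{m\times m}$ be symmetric positive semidefinite (possibly singular), and let $\rho_x>0$, $\rho_w>0$. Put $\hat P_x=\mathcal N(\hat\mu_x,\hat\Sigma_x)$ and $\hat P_w=\mathcal N(\hat\mu_w,\hat\Sigma_w)$. Let $W_2$ be the type-2 Wasserstein distance for the Euclidean norm, $W_2(P,Q)=\inf_{\pi}\big(\int\|\xi_1-\xi_2\|^2\,\mathrm d\pi(\xi_1,\xi_2)\big)^{1/2}$, the infimum being over all couplings $\pi$ of $P$ and $Q$. Let - $\mathcal F$ be the set of all Borel measurable functions $f:\mathbb R^m\to\mathbb R^n$, and $\mathcal F_L\subseteq\mathcal F$ the set of affine functions $f(y)=Ay+b$ with $A\in\mathbb R^{n\times m}$, $b\in\mathbb R^n$; - $\mathbb B$ be the set of product distributions $P_x\times P_w$ on $\mathbb R^n\times\mathbb R^m$, where $P_x$ and $P_w$ are probability distributions with finite second moments, $W_2(P_x,\hat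 P_x)\le\rho_x$ and $W_2(P_w,\hat P_w)\le\rho_w$; and $\mathbb B_{\mathcal N}\subseteq\mathbb B$ the subset of those for which $P_x$ and $P_w$ are both normal distributions (possibly degenerate); - $\mathrm{mse}(f,P)=\int_{\mathbb R^n\times\mathbb R^m}\|f(Hx+w)-x\|^2\,\mathrm dP(x,w)\in[0,\infty]$. A saddle point of $\inf_{f\in F}\sup_{P\in B}\mathrm{mse}(f,P)$ is a pair $(f^*,P^*)\in F\times B$ such that $\mathrm{mse}(f^*,P)\le\mathrm{mse}(f^*,P^*)\le\mathrm{mse}(f,P^*)$ for all $f\in F$ and $P\in B$. Then the problem $\inf_{f\in\mathcal F}\sup_{P\in\mathbb B}\mathrm{mse}(f,P)$ (WDRE) has a saddle point if and only if the problem $\inf_{f\in\mathcal F_L}\sup_{P\in\mathbb B_{\mathcal N}}\mathrm{mse}(f,P)$ (LG-WDRE) has a saddle point. Moreover, if (WDRE) has a saddle point, then there is a pair $(f^*,P^*)\in\mathcal F_L\times\mathbb B_{\mathcal N}$ that is a saddle point of both problems. -/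

import Mathlib

open MeasureTheory ProbabilityTheory
open scoped ENNReal

namespace WDRE

noncomputable section

/-- `ℝᵈ` with its Euclidean norm. -/
abbrev Vec (d : ℕ) : Type := EuclideanSpace ℝ (Fin d)

/-- `𝒫_d`: the probability distributions on `ℝᵈ` with finite second order moments. -/
def P2 (d : ℕ) : Set (Measure (Vec d)) :=
  {P | IsProbabilityMeasure P ∧ ∫⁻ x, ‖x‖ₑ ^ 2 ∂P < ∞}

/-- `Π(P, Q)`: the joint distributions with marginals `P` and `Q`. -/
def couplings {d : ℕ} (P Q : Measure (Vec d)) : Set (Measure (Vec d × Vec d)) :=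
  {π | π.map Prod.fst = P ∧ π.map Prod.snd = Q}

/-- The type-2 Wasserstein distance (with values in `[0, ∞]`). -/
def W2 {d : ℕ} (P Q : Measure (Vec d)) : ℝ≥0∞ :=
  ⨅ π ∈ couplings P Q, (∫⁻ z, ‖z.1 - z.2‖ₑ ^ 2 ∂π) ^ (1 / 2 : ℝ)

/-- The mean square error `∫ ‖f (H x + w) - x‖² dP(x, w)`, with values in `[0, ∞]`. -/
def mse {n m : ℕ} (H : Matrix (Fin m) (Fin n) ℝ) (f : Vec m → Vec n)
    (P : Measure (Vec n × Vec m)) : ℝ≥0∞ :=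
  ∫⁻ z, ‖f (H.toEuclideanLin z.1 + z.2) - z.1‖ₑ ^ 2 ∂P

/-- `ℱ`: all measurable estimators. -/
def estimators (n m : ℕ) : Set (Vec m → Vec n) :=
  {f | Measurable f}

/-- `ℱ_L`: the (affine) linear estimators `y ↦ A y + b`. -/
def linearEstimators (n m : ℕ) : Set (Vec m → Vec n) :=
  {f | f ∈ estimators n m ∧
    ∃ (A : Matrix (Fin n) (Fin m) ℝ) (b : Vec n), ∀ y, f y = A.toEuclideanLin y + b}

/-- `P` is a normal distribution `𝒩(μ, Σ)` with `Σ` positive semidefinite. -/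
def IsNormal {d : ℕ} (P : Measure (Vec d)) : Prop :=
  ∃ (μ : Vec d) (S : Matrix (Fin d) (Fin d) ℝ), S.PosSemidef ∧ P = multivariateGaussian μ S

/-- `𝔹(P̂)`: the products of distributions with finite second moments whose factors are within
Wasserstein distance `ρx`, `ρw` of `𝒩(μx, Sx)`, `𝒩(μw, Sw)`. -/
def ball {n m : ℕ} (μx : Vec n) (Sx : Matrix (Fin n) (Fin n) ℝ) (ρx : ℝ)
    (μw : Vec m) (Sw : Matrix (Fin m) (Fin m) ℝ) (ρw : ℝ) : Set (Measure (Vec n × Vec m)) :=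
  {P | ∃ (Px : Measure (Vec n)) (Pw : Measure (Vec m)), P = Px.prod Pw ∧
    Px ∈ P2 n ∧ Pw ∈ P2 m ∧
    W2 Px (multivariateGaussian μx Sx) ≤ ENNReal.ofReal ρx ∧
    W2 Pw (multivariateGaussian μw Sw) ≤ ENNReal.ofReal ρw}

/-- `𝔹_𝒩(P̂)`: the same with both factors restricted to normal distributions. -/
def gaussianBall {n m : ℕ} (μx : Vec n) (Sx : Matrix (Fin n) (Fin n) ℝ) (ρx : ℝ)
    (μw : Vec m) (Sw : Matrix (Fin m) (Fin m) ℝ) (ρw : ℝ) : Set (Measure (Vec n × Vec m)) :=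
  {P | ∃ (Px : Measure (Vec n)) (Pw : Measure (Vec m)), P = Px.prod Pw ∧
    Px ∈ P2 n ∧ Pw ∈ P2 m ∧
    W2 Px (multivariateGaussian μx Sx) ≤ ENNReal.ofReal ρx ∧
    W2 Pw (multivariateGaussian μw Sw) ≤ ENNReal.ofReal ρw ∧
    IsNormal Px ∧ IsNormal Pw}

/-- `(f, P)` is a saddle point solution of `inf_{f ∈ F} sup_{P ∈ B} φ f P`: both components are
feasible, and `φ f Q ≤ φ f P ≤ φ g P` for all `g ∈ F`, `Q ∈ B`. -/
def IsSaddleSolution {α β : Type*} (F : Set α) (B : Set β) (φ : α → β → ℝ≥0∞)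
    (f : α) (P : β) : Prop :=
  f ∈ F ∧ P ∈ B ∧ (∀ Q ∈ B, φ f Q ≤ φ f P) ∧ (∀ g ∈ F, φ f P ≤ φ g P)

end

end WDRE

/-! The error of an affine estimator depends on a product distribution only through the means and
covariances of the factors. Each moment pair occurring in the ball also occurs for a normal
distribution in the ball, because the block covariance matrix of a coupling is that of a Gaussian
coupling of equal cost (`exists_feas`, `Feas.near`). Under normal distributions some affine
estimator beats all others (`exists_affine_optimal`). Hence a saddle point of (LG-WDRE) is one of
(WDRE).

Conversely, let `f`, possibly nonlinear, belong to a saddle point of value `v`. Normal distributions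
with the adversary's covariances `Sx`, `Sw`, centred at the nominal means, are least favourable:
every estimator has error at least `v` there. What is missing is an affine estimator with error at
most `v` on the whole ball. Affine errors are convex in the matrix `A`, so by a minimax theorem and
compactness it suffices to find, for finitely many feasible moments with weights `pᵢ` and each `ε >
0`, an `A` of averaged error at most `v + ε` (`exists_forall_le_of_compact_sublevel`). The obstacle
is that a mixture of products is not a product, while `f` is controlled only on products.

A perturbation removes it (`exists_mixture_le`). With `g` standard Gaussian, shift both means by `√t
∑ √pᵢ gᵢ δᵢ`, using the same `g`, and replace each covariance `S` by `t ∑ pᵢ Tᵢ + (1 - t) S`.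
Averaged over `g` this is a jointly Gaussian model, so `f` does no better than some affine
estimator, whose error is at least `(1 - t) v` plus `t` times the averaged error sought. For fixed
`g` it is a product whose cost bounds exceed the budgets by `t sx` and `t sw`, both of mean zero.
Mixing each factor with a normal distribution whose budget is moved the other way compensates the
excess. Such a distribution can be chosen so that the least error responds to the budget with a
slope `Λ`, up to second order (`exists_path`). This bounds the error of `f` by `v + t (1 - t) (Λx sx
+ Λw sw)` plus terms of order `t²` and `t η`, where `η` is the size of the compensation. The terms
in `Λ` average to zero; divide by `t` and make `η`, then `t`, small. -/

namespace WDRE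

open Matrix

noncomputable section

/-! ### Moments, and the error of affine estimators -/

section

/-- The mean vector of a distribution on `ℝᵈ`. -/
def meanVec {d : ℕ} (P : Measure (Vec d)) : Vec d := WithLp.toLp 2 fun i => ∫ x, x i ∂P

/-- The covariance matrix of a distribution on `ℝᵈ`. -/
def covMat {d : ℕ} (P : Measure (Vec d)) : Matrix (Fin d) (Fin d) ℝ :=
  Matrix.of fun i j => cov[fun x => x i, fun x => x j; P]

/-- The trace form `tr (K S Kᵀ)`. -/
def quad {k d : ℕ} (K : Matrix (Fin k) (Fin d) ℝ) (S : Matrix (Fin d) (Fin d) ℝ) : ℝ :=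
  (K * S * Kᵀ).trace

lemma quad_eq_sum {k d : ℕ} (K : Matrix (Fin k) (Fin d) ℝ) (S : Matrix (Fin d) (Fin d) ℝ) :
    quad K S = ∑ i, ∑ j, ∑ l, K i j * K i l * S j l := by
  unfold quad Matrix.trace
  refine Finset.sum_congr rfl fun i _ => ?_
  simp only [diag_apply, mul_apply, transpose_apply, Finset.sum_mul]
  rw [Finset.sum_comm]
  exact Finset.sum_congr rfl fun j _ => Finset.sum_congr rfl fun l _ => by ring

lemma quad_nonneg {k d : ℕ} (K : Matrix (Fin k) (Fin d) ℝ) {S : Matrix (Fin d) (Fin d) ℝ}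
    (hS : S.PosSemidef) : 0 ≤ quad K S := by
  have := (hS.mul_mul_conjTranspose_same K).trace_nonneg
  rwa [conjTranspose_eq_transpose_of_trivial] at this

lemma toEuclideanLin_coord {k d : ℕ} (K : Matrix (Fin k) (Fin d) ℝ) (x : Vec d) (i : Fin k) :
    K.toEuclideanLin x i = ∑ j, K i j * x j := by
  simp [Matrix.toLpLin_apply, mulVec, dotProduct]

@[fun_prop]
lemma measurable_toEuclideanLin {k d : ℕ} (K : Matrix (Fin k) (Fin d) ℝ) :
    Measurable (fun x : Vec d => K.toEuclideanLin x) :=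
  (LinearMap.continuous_of_finiteDimensional _).measurable

lemma enorm_sq_eq {E : Type*} [NormedAddCommGroup E] (x : E) :
    ‖x‖ₑ ^ 2 = ENNReal.ofReal (‖x‖ ^ 2) := by
  rw [← ofReal_norm, ENNReal.ofReal_pow (norm_nonneg _)]

lemma norm_sq_eq_sum {d : ℕ} (x : Vec d) : ‖x‖ ^ 2 = ∑ i, x i ^ 2 := by
  rw [EuclideanSpace.norm_sq_eq]
  simp

variable {Ω : Type*} [MeasurableSpace Ω]

lemma lintegral_enorm_sq_eq {d : ℕ} {P : Measure Ω} [IsProbabilityMeasure P] {Z : Ω → Vec d}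
    (hZ : ∀ i, MemLp (fun ω => Z ω i) 2 P) :
    ∫⁻ ω, ‖Z ω‖ₑ ^ 2 ∂P
      = ENNReal.ofReal (∑ i, (Var[fun ω => Z ω i; P] + (∫ ω, Z ω i ∂P) ^ 2)) := by
  simp_rw [enorm_sq_eq, norm_sq_eq_sum]
  have hint : ∀ i, Integrable (fun ω => Z ω i ^ 2) P := fun i => (hZ i).integrable_sq
  rw [← ofReal_integral_eq_lintegral_ofReal (integrable_finsetSum _ fun i _ => hint i)
    (Filter.Eventually.of_forall fun ω => Finset.sum_nonneg fun i _ => sq_nonneg _),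
    integral_finsetSum _ fun i _ => hint i]
  congr 1
  refine Finset.sum_congr rfl fun i _ => ?_
  rw [variance_eq_sub (hZ i)]
  simp

lemma memLp_coord {d : ℕ} {P : Measure Ω} {Z : Ω → Vec d} (hm : AEStronglyMeasurable Z P)
    (h : ∫⁻ ω, ‖Z ω‖ₑ ^ 2 ∂P < ∞) (i : Fin d) : MemLp (fun ω => Z ω i) 2 P := by
  have hZ : MemLp Z 2 P := by
    refine ⟨hm, ?_⟩
    rw [eLpNorm_lt_top_iff_lintegral_rpow_enorm_lt_top (by norm_num) (by norm_num)]
    simpa using h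
  exact (EuclideanSpace.proj (𝕜 := ℝ) i).comp_memLp' hZ

lemma P2.memLp {d : ℕ} {P : Measure (Vec d)} (hP : P ∈ P2 d) (i : Fin d) :
    MemLp (fun x : Vec d => x i) 2 P :=
  memLp_coord (Z := fun x => x) aestronglyMeasurable_id hP.2 i

lemma lintegral_enorm_sq_affine {k d : ℕ} {P : Measure (Vec d)} (hP : P ∈ P2 d)
    (K : Matrix (Fin k) (Fin d) ℝ) (c : Vec k) :
    ∫⁻ x, ‖K.toEuclideanLin x + c‖ₑ ^ 2 ∂P
      = ENNReal.ofReal (quad K (covMat P) + ‖K.toEuclideanLin (meanVec P) + c‖ ^ 2) := by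
  have := hP.1
  have hL := P2.memLp hP
  have hc : ∀ i j, MemLp (fun x : Vec d => K i j * x j) 2 P := fun i j => (hL j).const_mul _
  have hs : ∀ i, MemLp (fun x : Vec d => ∑ j, K i j * x j) 2 P := fun i =>
    memLp_finsetSum _ fun j _ => hc i j
  rw [lintegral_enorm_sq_eq]
  · congr 1
    rw [Finset.sum_add_distrib]
    congr 1
    · rw [quad_eq_sum]
      refine Finset.sum_congr rfl fun i _ => ?_
      simp only [PiLp.add_apply, toEuclideanLin_coord]
      rw [variance_add_const (hs i).aestronglyMeasurable, variance_fun_sum (hc i)]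
      refine Finset.sum_congr rfl fun j _ => Finset.sum_congr rfl fun l _ => ?_
      rw [covariance_const_mul_left, covariance_const_mul_right, covMat, Matrix.of_apply]
      ring
    · rw [norm_sq_eq_sum]
      refine Finset.sum_congr rfl fun i _ => ?_
      simp only [PiLp.add_apply, toEuclideanLin_coord, meanVec]
      rw [integral_add ((hs i).integrable (by norm_num)) (integrable_const _),
        integral_finsetSum _ fun j _ => (hc i j).integrable (by norm_num)]
      simp [integral_const_mul]
  · intro i
    simp only [PiLp.add_apply, toEuclideanLin_coord]
    exact (hs i).add (memLp_const _)

lemma covMat_multivariateGaussian {d : ℕ} (μ : Vec d) {S : Matrix (Fin d) (Fin d) ℝ}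
    (hS : S.PosSemidef) : covMat (multivariateGaussian μ S) = S := by
  ext i j
  exact covariance_eval_multivariateGaussian hS i j

lemma meanVec_of_integral {d : ℕ} {P : Measure (Vec d)} (h : Integrable (fun x => x) P) :
    meanVec P = ∫ x, x ∂P := by
  ext i
  simp only [meanVec]
  exact (EuclideanSpace.proj (𝕜 := ℝ) i).integral_comp_comm h

lemma meanVec_multivariateGaussian {d : ℕ} (μ : Vec d) (S : Matrix (Fin d) (Fin d) ℝ) :
    meanVec (multivariateGaussian μ S) = μ := by
  rw [meanVec_of_integral IsGaussian.integrable_id]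
  exact integral_id_multivariateGaussian

lemma P2_of_isGaussian {d : ℕ} (P : Measure (Vec d)) [IsGaussian P] : P ∈ P2 d := by
  refine ⟨inferInstance, ?_⟩
  have h := (IsGaussian.memLp_two_id (μ := P)).2
  rw [eLpNorm_lt_top_iff_lintegral_rpow_enorm_lt_top (by norm_num) (by norm_num)] at h
  simpa using h

lemma covMat_posSemidef {d : ℕ} {P : Measure (Vec d)} (hP : P ∈ P2 d) :
    (covMat P).PosSemidef := by
  have := hP.1
  rw [Matrix.posSemidef_iff_dotProduct_mulVec]
  refine ⟨?_, fun v => ?_⟩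
  · ext i j
    simp [covMat, covariance_comm]
  · have h : star v ⬝ᵥ (covMat P) *ᵥ v = Var[fun x : Vec d => ∑ i, v i * x i; P] := by
      rw [variance_fun_sum fun i => (P2.memLp hP i).const_mul _]
      simp only [dotProduct, mulVec, covMat, Pi.star_apply, star_trivial, of_apply,
        covariance_const_mul_left, covariance_const_mul_right, Finset.mul_sum]
      exact Finset.sum_congr rfl fun i _ => Finset.sum_congr rfl fun j _ => by ring
    rw [h]
    exact variance_nonneg _ _

/-- The error `‖A (H x + w) + b - x‖²` of an affine estimator under a product distribution. -/
lemma mse_affine {n m : ℕ} (H : Matrix (Fin m) (Fin n) ℝ) (A : Matrix (Fin n) (Fin m) ℝ)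
    (c : Vec n) {f : Vec m → Vec n} (hf : ∀ y, f y = A.toEuclideanLin y + c)
    {Px : Measure (Vec n)} {Pw : Measure (Vec m)} (hx : Px ∈ P2 n) (hw : Pw ∈ P2 m) :
    mse H f (Px.prod Pw) = ENNReal.ofReal (quad (A * H - 1) (covMat Px) + quad A (covMat Pw)
      + ‖(A * H - 1).toEuclideanLin (meanVec Px) + A.toEuclideanLin (meanVec Pw) + c‖ ^ 2) := by
  have := hx.1
  have := hw.1
  have hfm : Measurable f := by
    have : f = fun y => A.toEuclideanLin y + c := funext hf
    rw [this]; fun_prop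
  have key : ∀ x w, f (H.toEuclideanLin x + w) - x
      = A.toEuclideanLin w + ((A * H - 1).toEuclideanLin x + c) := by
    intro x w
    have h1 : (A * H - 1).toEuclideanLin x = A.toEuclideanLin (H.toEuclideanLin x) - x := by
      ext i
      simp [Matrix.toLpLin_apply]
    rw [hf, map_add, h1]
    abel
  unfold mse
  rw [lintegral_prod _ (by fun_prop)]
  simp_rw [key, lintegral_enorm_sq_affine hw]
  have hq := quad_nonneg A (covMat_posSemidef hw)
  have hq' := quad_nonneg (A * H - 1) (covMat_posSemidef hx)
  simp_rw [ENNReal.ofReal_add hq (sq_nonneg _)]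
  rw [lintegral_add_left measurable_const]
  simp only [lintegral_const, measure_univ, mul_one]
  have h2 : ∀ x : Vec n, A.toEuclideanLin (meanVec Pw) + ((A * H - 1).toEuclideanLin x + c)
      = (A * H - 1).toEuclideanLin x + (A.toEuclideanLin (meanVec Pw) + c) := fun x => by abel
  simp_rw [h2, ← enorm_sq_eq]
  rw [lintegral_enorm_sq_affine hx, ← ENNReal.ofReal_add hq (by positivity)]
  congr 1
  rw [← add_assoc (toEuclideanLin (A * H - 1) _)]
  ring

end

/-! ### Couplings, their covariance matrices, and reduction to normal distributions -/

section

/-- `(μ + d, S)` are the moments of a distribution that admits, with `𝒩(μ, S₀)`, a coupling of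
cross covariance `C` and of quadratic cost at most `r`. -/
def Feas {d : ℕ} (S₀ : Matrix (Fin d) (Fin d) ℝ) (r : ℝ) (δ : Vec d)
    (S C : Matrix (Fin d) (Fin d) ℝ) : Prop :=
  (fromBlocks S C Cᵀ S₀).PosSemidef ∧ ‖δ‖ ^ 2 + S.trace + S₀.trace - 2 * C.trace ≤ r

/-- `P` has finite second moments and a coupling with `P₀` of quadratic cost at most `c`. -/
def Near {d : ℕ} (P₀ : Measure (Vec d)) (c : ℝ) (P : Measure (Vec d)) : Prop :=
  P ∈ P2 d ∧ ∃ π ∈ couplings P P₀, ∫⁻ z, ‖z.1 - z.2‖ₑ ^ 2 ∂π ≤ ENNReal.ofReal c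

variable {d : ℕ}

lemma Feas.posSemidef {S₀ S C : Matrix (Fin d) (Fin d) ℝ} {r : ℝ} {δ : Vec d}
    (h : Feas S₀ r δ S C) : S.PosSemidef := by
  have := h.1.submatrix (Sum.inl : Fin d → Fin d ⊕ Fin d)
  have e : (fromBlocks S C Cᵀ S₀).submatrix Sum.inl Sum.inl = S := by ext i j; simp
  rwa [e] at this

lemma multivariateGaussian_map_add (μ δ : Vec d) (S : Matrix (Fin d) (Fin d) ℝ) :
    (multivariateGaussian μ S).map (fun x => x + δ) = multivariateGaussian (μ + δ) S := by
  unfold multivariateGaussian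
  rw [Measure.map_map (by fun_prop) (by fun_prop)]
  congr 1
  ext1 x
  simp only [Function.comp]
  abel

/-- The projection of a Euclidean space to some of its coordinates. -/
def coordCLM {ι : Type*} [Fintype ι] (e : Fin d → ι) : EuclideanSpace ℝ ι →L[ℝ] Vec d :=
  LinearMap.toContinuousLinearMap
    { toFun := fun z => WithLp.toLp 2 fun i => z (e i)
      map_add' := fun _ _ => rfl
      map_smul' := fun _ _ => rfl }

lemma coordCLM_apply {ι : Type*} [Fintype ι] (e : Fin d → ι) (z : EuclideanSpace ℝ ι) (i : Fin d) :
    coordCLM e z i = z (e i) := rfl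

lemma multivariateGaussian_map_coord {ι : Type*} [Fintype ι] [DecidableEq ι] (e : Fin d → ι)
    {B : Matrix ι ι ℝ} (hB : B.PosSemidef) :
    (multivariateGaussian 0 B).map (coordCLM e) = multivariateGaussian 0 (B.submatrix e e) := by
  apply IsGaussian.ext
  · simp only [id_eq, integral_id_multivariateGaussian]
    rw [ContinuousLinearMap.integral_id_map, integral_id_multivariateGaussian, map_zero]
    exact IsGaussian.integrable_id
  rw [← ContinuousLinearMap.toBilinForm_inj]
  refine LinearMap.BilinForm.ext_basis (EuclideanSpace.basisFun (Fin d) ℝ).toBasis fun i j ↦ ?_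
  rw [ContinuousLinearMap.toBilinForm_apply, ContinuousLinearMap.toBilinForm_apply,
    covarianceBilin_apply_eq_cov, covariance_map]
  · have (i : Fin d) : (fun u ↦ inner ℝ ((EuclideanSpace.basisFun (Fin d) ℝ).toBasis i) u) ∘
        coordCLM e = fun u ↦ u (e i) := by
      ext; simp [PiLp.inner_apply, coordCLM_apply]
    simp_rw [this, covariance_eval_multivariateGaussian hB,
      covarianceBilin_multivariateGaussian (hB.submatrix _)]
    simp
  any_goals exact Measurable.aestronglyMeasurable (by fun_prop)
  · fun_prop
  · exact IsGaussian.memLp_two_id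

lemma couplings_isProbabilityMeasure {P Q : Measure (Vec d)} {π : Measure (Vec d × Vec d)}
    (hπ : π ∈ couplings P Q) (hP : P ∈ P2 d) : IsProbabilityMeasure π := by
  have := hP.1
  rw [← hπ.1] at this
  exact Measure.isProbabilityMeasure_of_map Prod.fst

lemma memLp_fst {P Q : Measure (Vec d)} {π : Measure (Vec d × Vec d)}
    (hπ : π ∈ couplings P Q) (hP : P ∈ P2 d) (i : Fin d) : MemLp (fun z => z.1 i) 2 π := by
  have h := P2.memLp hP i
  rw [← hπ.1, memLp_map_measure_iff (by fun_prop) (by fun_prop)] at h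
  exact h

lemma memLp_snd {P Q : Measure (Vec d)} {π : Measure (Vec d × Vec d)}
    (hπ : π ∈ couplings P Q) (hQ : Q ∈ P2 d) (i : Fin d) : MemLp (fun z => z.2 i) 2 π := by
  have h := P2.memLp hQ i
  rw [← hπ.2, memLp_map_measure_iff (by fun_prop) (by fun_prop)] at h
  exact h

lemma lintegral_coupling {P Q : Measure (Vec d)} {π : Measure (Vec d × Vec d)}
    (hπ : π ∈ couplings P Q) (hP : P ∈ P2 d) (hQ : Q ∈ P2 d) :
    ∫⁻ z, ‖z.1 - z.2‖ₑ ^ 2 ∂π = ENNReal.ofReal (‖meanVec P - meanVec Q‖ ^ 2 + (covMat P).trace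
      + (covMat Q).trace - 2 * ∑ i, cov[fun z => z.1 i, fun z => z.2 i; π]) := by
  have := couplings_isProbabilityMeasure hπ hP
  have h1 := memLp_fst hπ hP
  have h2 := memLp_snd hπ hQ
  rw [lintegral_enorm_sq_eq (fun i => (h1 i).sub (h2 i))]
  congr 1
  rw [norm_sq_eq_sum, Matrix.trace, Matrix.trace, Finset.mul_sum, ← Finset.sum_add_distrib,
    ← Finset.sum_add_distrib, ← Finset.sum_sub_distrib]
  refine Finset.sum_congr rfl fun i _ => ?_
  have e1 : ∫ z, z.1 i ∂π = ∫ x, x i ∂P := by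
    rw [← hπ.1, integral_map (by fun_prop) (by fun_prop)]
  have e2 : ∫ z, z.2 i ∂π = ∫ x, x i ∂Q := by
    rw [← hπ.2, integral_map (by fun_prop) (by fun_prop)]
  have v1 : Var[fun z => z.1 i; π] = Var[fun x => x i; P] := by
    rw [← hπ.1, variance_map (by fun_prop) (by fun_prop)]; rfl
  have v2 : Var[fun z => z.2 i; π] = Var[fun x => x i; Q] := by
    rw [← hπ.2, variance_map (by fun_prop) (by fun_prop)]; rfl
  simp only [PiLp.sub_apply, meanVec, covMat, diag_apply, of_apply]
  rw [integral_sub ((h1 i).integrable (by norm_num)) ((h2 i).integrable (by norm_num)),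
    variance_fun_sub (h1 i) (h2 i), e1, e2, v1, v2, covariance_self (by fun_prop),
    covariance_self (by fun_prop)]
  ring

/-- The coupling is the Gaussian on the sum of the two spaces whose covariance is the block matrix,
translated to the prescribed means. -/
lemma Feas.near {S₀ S C : Matrix (Fin d) (Fin d) ℝ} {r : ℝ} {δ : Vec d}
    (h : Feas S₀ r δ S C) (μ : Vec d) :
    Near (multivariateGaussian μ S₀) r (multivariateGaussian (μ + δ) S) := by
  set B := fromBlocks S C Cᵀ S₀ with hB
  have hS := h.posSemidef
  have hS₀ : S₀.PosSemidef := by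
    have := h.1.submatrix (Sum.inr : Fin d → Fin d ⊕ Fin d)
    have e : (fromBlocks S C Cᵀ S₀).submatrix Sum.inr Sum.inr = S₀ := by ext i j; simp
    rwa [e] at this
  have m1 : B.submatrix Sum.inl Sum.inl = S := by ext i j; simp [hB]
  have m2 : B.submatrix Sum.inr Sum.inr = S₀ := by ext i j; simp [hB]
  set G := multivariateGaussian (0 : EuclideanSpace ℝ (Fin d ⊕ Fin d)) B with hG
  set F : EuclideanSpace ℝ (Fin d ⊕ Fin d) → Vec d × Vec d :=
    fun z => (coordCLM Sum.inl z + (μ + δ), coordCLM Sum.inr z + μ) with hF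
  have hFm : Measurable F := by fun_prop
  have hπ : G.map F ∈ couplings (multivariateGaussian (μ + δ) S) (multivariateGaussian μ S₀) := by
    constructor
    · rw [Measure.map_map (by fun_prop) hFm]
      have e : Prod.fst ∘ F = (fun x => x + (μ + δ)) ∘ (coordCLM Sum.inl) := rfl
      rw [e, ← Measure.map_map (by fun_prop) (by fun_prop), hG,
        multivariateGaussian_map_coord Sum.inl h.1, m1, multivariateGaussian_map_add, zero_add]
    · rw [Measure.map_map (by fun_prop) hFm]
      have e : Prod.snd ∘ F = (fun x => x + μ) ∘ (coordCLM Sum.inr) := rfl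
      rw [e, ← Measure.map_map (by fun_prop) (by fun_prop), hG,
        multivariateGaussian_map_coord Sum.inr h.1, m2, multivariateGaussian_map_add, zero_add]
  refine ⟨P2_of_isGaussian _, G.map F, hπ, ?_⟩
  rw [lintegral_coupling hπ (P2_of_isGaussian _) (P2_of_isGaussian _),
    covMat_multivariateGaussian _ hS, covMat_multivariateGaussian _ hS₀,
    meanVec_multivariateGaussian, meanVec_multivariateGaussian, add_sub_cancel_left]
  have hc : ∀ i, cov[fun z => z.1 i, fun z => z.2 i; G.map F] = C i i := by
    intro i
    rw [covariance_map (by fun_prop) (by fun_prop) (by fun_prop)]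
    have e1 : (fun z : Vec d × Vec d => z.1 i) ∘ F = fun z => z (Sum.inl i) + (μ + δ) i := rfl
    have e2 : (fun z : Vec d × Vec d => z.2 i) ∘ F = fun z => z (Sum.inr i) + μ i := rfl
    have hl : ∀ k, MemLp (fun z : EuclideanSpace ℝ (Fin d ⊕ Fin d) => z k) 2 G := fun k =>
      (EuclideanSpace.proj (𝕜 := ℝ) k).comp_memLp' IsGaussian.memLp_two_id
    rw [e1, e2, covariance_add_const_left ((hl _).integrable (by norm_num)),
      covariance_add_const_right ((hl _).integrable (by norm_num)),
      covariance_eval_multivariateGaussian h.1]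
    simp
  simp_rw [hc]
  exact ENNReal.ofReal_le_ofReal h.2

lemma Near.W2_le {P₀ P : Measure (Vec d)} {ρ : ℝ} (h : Near P₀ (ρ ^ 2) P) (hρ : 0 ≤ ρ) :
    W2 P P₀ ≤ ENNReal.ofReal ρ := by
  obtain ⟨-, π, hπ, hc⟩ := h
  refine (iInf₂_le π hπ).trans ?_
  calc (∫⁻ z, ‖z.1 - z.2‖ₑ ^ 2 ∂π) ^ (1 / 2 : ℝ) ≤ (ENNReal.ofReal (ρ ^ 2)) ^ (1 / 2 : ℝ) :=
        ENNReal.rpow_le_rpow hc (by norm_num)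
    _ = ENNReal.ofReal ρ := by
        rw [ENNReal.ofReal_rpow_of_nonneg (by positivity) (by norm_num),
          ← Real.rpow_natCast, ← Real.rpow_mul hρ]
        norm_num

/-- The cross covariance of a coupling. -/
def crossCov (π : Measure (Vec d × Vec d)) : Matrix (Fin d) (Fin d) ℝ :=
  Matrix.of fun i j => cov[fun z => z.1 i, fun z => z.2 j; π]

lemma crossCov_posSemidef {P Q : Measure (Vec d)} {π : Measure (Vec d × Vec d)}
    (hπ : π ∈ couplings P Q) (hP : P ∈ P2 d) (hQ : Q ∈ P2 d) :
    (fromBlocks (covMat P) (crossCov π) (crossCov π)ᵀ (covMat Q)).PosSemidef := by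
  have := couplings_isProbabilityMeasure hπ hP
  set X : Fin d ⊕ Fin d → Vec d × Vec d → ℝ :=
    fun k z => Sum.elim (fun i => z.1 i) (fun i => z.2 i) k with hX
  have hl : ∀ k, MemLp (X k) 2 π := by
    rintro (i | i)
    · exact memLp_fst hπ hP i
    · exact memLp_snd hπ hQ i
  have hB : fromBlocks (covMat P) (crossCov π) (crossCov π)ᵀ (covMat Q)
      = Matrix.of fun k l => cov[X k, X l; π] := by
    ext k l
    rcases k with i | i <;> rcases l with j | j
    · simp only [fromBlocks_apply₁₁, covMat, of_apply, ← hπ.1]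
      rw [covariance_map (by fun_prop) (by fun_prop) (by fun_prop)]; rfl
    · rfl
    · simp only [fromBlocks_apply₂₁, crossCov, of_apply, transpose_apply]
      rw [covariance_comm]; rfl
    · simp only [fromBlocks_apply₂₂, covMat, of_apply, ← hπ.2]
      rw [covariance_map (by fun_prop) (by fun_prop) (by fun_prop)]; rfl
  rw [hB, Matrix.posSemidef_iff_dotProduct_mulVec]
  refine ⟨by ext k l; simp [covariance_comm], fun v => ?_⟩
  have h : star v ⬝ᵥ (Matrix.of fun k l => cov[X k, X l; π]) *ᵥ v
      = Var[fun z => ∑ k, v k * X k z; π] := by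
    rw [variance_fun_sum fun k => (hl k).const_mul _]
    simp only [dotProduct, mulVec, Pi.star_apply, star_trivial, of_apply,
      covariance_const_mul_left, covariance_const_mul_right, Finset.mul_sum]
    exact Finset.sum_congr rfl fun i _ => Finset.sum_congr rfl fun j _ => by ring
  rw [h]
  exact variance_nonneg _ _

lemma isClosed_posSemidef {ι : Type*} [Fintype ι] :
    IsClosed {B : Matrix ι ι ℝ | B.PosSemidef} := by
  have : {B : Matrix ι ι ℝ | B.PosSemidef}
      = {B | Bᴴ = B} ∩ ⋂ v : ι → ℝ, {B | 0 ≤ star v ⬝ᵥ B *ᵥ v} := by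
    ext B
    simp [Matrix.posSemidef_iff_dotProduct_mulVec, Matrix.IsHermitian]
  rw [this]
  refine (isClosed_eq (by fun_prop) continuous_id).inter (isClosed_iInter fun v => ?_)
  exact isClosed_le continuous_const (by fun_prop)

/-- Test vectors `eᵢ ± eⱼ`. The bound makes the set of cross covariances with given diagonal blocks
compact. -/
lemma abs_le_of_block_posSemidef {S C S₀ : Matrix (Fin d) (Fin d) ℝ}
    (h : (fromBlocks S C Cᵀ S₀).PosSemidef) (i j : Fin d) : |C i j| ≤ S i i + S₀ j j := by
  have key : ∀ s : ℝ, 0 ≤ S i i + 2 * s * C i j + s ^ 2 * S₀ j j := by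
    intro s
    have := (Matrix.posSemidef_iff_dotProduct_mulVec.1 h).2
      (Sum.elim (Pi.single i 1) (Pi.single j s))
    simp [fromBlocks_mulVec, dotProduct_add, mulVec_single] at this
    nlinarith
  have h1 := key 1
  have h2 := key (-1)
  have h3 := key 0
  have : 0 ≤ S₀ j j := by
    have := h.diag_nonneg (i := Sum.inr j)
    simpa using this
  have h4 : 0 ≤ S i i := by simpa using h3
  rw [abs_le]
  constructor <;> nlinarith

/-- The infimum in `W2` is approached by couplings whose cross covariances lie in a compact set. A
`C` of maximal trace there does at least as well as all of them, so no optimal coupling is needed.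
-/
lemma exists_feas {P : Measure (Vec d)} (hP : P ∈ P2 d) {μ : Vec d}
    {S₀ : Matrix (Fin d) (Fin d) ℝ} (hS₀ : S₀.PosSemidef) {ρ : ℝ} (hρ : 0 ≤ ρ)
    (h : W2 P (multivariateGaussian μ S₀) ≤ ENNReal.ofReal ρ) :
    ∃ C, Feas S₀ (ρ ^ 2) (meanVec P - μ) (covMat P) C := by
  set K := {C : Matrix (Fin d) (Fin d) ℝ | (fromBlocks (covMat P) C Cᵀ S₀).PosSemidef} with hK
  have hKc : IsCompact K := by
    have hcl : IsClosed K := isClosed_posSemidef.preimage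
      (f := fun C => fromBlocks (covMat P) C Cᵀ S₀) (by fun_prop)
    have hbd : K ⊆ Set.univ.pi fun i => Set.univ.pi fun j =>
        Set.Icc (-(covMat P i i + S₀ j j)) (covMat P i i + S₀ j j) := by
      intro C hC i _ j _
      exact abs_le.1 (abs_le_of_block_posSemidef hC i j)
    exact (isCompact_univ_pi fun i => isCompact_univ_pi fun j => isCompact_Icc).of_isClosed_subset
      hcl hbd
  have hap : ∀ ε > 0, ∃ C ∈ K, ‖meanVec P - μ‖ ^ 2 + (covMat P).trace + S₀.trace
      - 2 * C.trace ≤ (ρ + ε) ^ 2 := by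
    intro ε hε
    have hlt : W2 P (multivariateGaussian μ S₀) < ENNReal.ofReal (ρ + ε) :=
      h.trans_lt ((ENNReal.ofReal_lt_ofReal_iff (by linarith)).2 (by linarith))
    simp only [W2, iInf_lt_iff] at hlt
    obtain ⟨π, hπ, hlt⟩ := hlt
    have hG := P2_of_isGaussian (multivariateGaussian μ S₀)
    have hps := crossCov_posSemidef hπ hP hG
    have hc := lintegral_coupling hπ hP hG
    rw [covMat_multivariateGaussian _ hS₀] at hps hc
    rw [meanVec_multivariateGaussian] at hc
    refine ⟨crossCov π, hps, ?_⟩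
    rw [hc, ← ENNReal.rpow_lt_rpow_iff (z := 2) (by norm_num), ← ENNReal.rpow_mul] at hlt
    norm_num at hlt
    rw [← ENNReal.ofReal_pow (by linarith), ENNReal.ofReal_lt_ofReal_iff (by positivity)] at hlt
    exact hlt.le
  obtain ⟨C₁, hC₁, -⟩ := hap 1 one_pos
  obtain ⟨C, hC, hmax⟩ := hKc.exists_isMaxOn ⟨C₁, hC₁⟩
    (f := fun C => C.trace) (Continuous.continuousOn (by fun_prop))
  refine ⟨C, hC, ?_⟩
  have hle : ∀ ε > 0, ‖meanVec P - μ‖ ^ 2 + (covMat P).trace + S₀.trace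
      - 2 * C.trace ≤ (ρ + ε) ^ 2 := by
    intro ε hε
    obtain ⟨C', hC', hle⟩ := hap ε hε
    have : C'.trace ≤ C.trace := hmax hC'
    linarith
  have ht : Filter.Tendsto (fun ε : ℝ => (ρ + ε) ^ 2) (nhdsWithin 0 (Set.Ioi 0))
      (nhds ((ρ + 0) ^ 2)) :=
    (Continuous.tendsto (by fun_prop) 0).mono_left nhdsWithin_le_nhds
  rw [add_zero] at ht
  exact ge_of_tendsto ht (Filter.eventually_of_mem self_mem_nhdsWithin fun ε hε => hle ε hε)

end

/-! ### Optimality of affine estimators in Gaussian models -/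

section

/-- The coefficients come from the orthogonal projection of the centred `x` onto the span of the
centred `y j` in `L²`. The covariance matrix of `y` is never inverted, so it may be singular. -/
lemma exists_regression {Ω : Type*} [MeasurableSpace Ω] {P : Measure Ω} [IsProbabilityMeasure P]
    {k : ℕ} {x : Ω → ℝ} {y : Fin k → Ω → ℝ} (hx : MemLp x 2 P) (hy : ∀ j, MemLp (y j) 2 P) :
    ∃ a : Fin k → ℝ, ∀ j, cov[fun ω => x ω - ∑ l, a l * y l ω, y j; P] = 0 := by
  have hx' : MemLp (fun ω => x ω - ∫ ω, x ω ∂P) 2 P := hx.sub (memLp_const _)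
  have hy' : ∀ j, MemLp (fun ω => y j ω - ∫ ω, y j ω ∂P) 2 P := fun j => (hy j).sub (memLp_const _)
  set ξ : Lp ℝ 2 P := hx'.toLp
  set η : Fin k → Lp ℝ 2 P := fun j => (hy' j).toLp
  set K := Submodule.span ℝ (Set.range η) with hK
  have : FiniteDimensional ℝ K := FiniteDimensional.span_of_finite ℝ (Set.finite_range η)
  obtain ⟨a, ha⟩ := (Submodule.mem_span_range_iff_exists_fun ℝ).1 (K.starProjection_apply_mem ξ)
  have hinner : ∀ j, inner ℝ (ξ - ∑ l, a l • η l) (η j) = 0 := by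
    intro j
    rw [ha]
    exact (K.mem_orthogonal' _).1 (K.sub_starProjection_mem_orthogonal ξ) _
      (Submodule.subset_span ⟨j, rfl⟩)
  have hsum : ∀ l, MemLp (fun ω => a l * y l ω) 2 P := fun l => (hy l).const_mul _
  have cL : ∀ (u v : Ω → ℝ) (hu : MemLp (fun ω => u ω - ∫ ω, u ω ∂P) 2 P)
      (hv : MemLp (fun ω => v ω - ∫ ω, v ω ∂P) 2 P), inner ℝ hu.toLp hv.toLp = cov[u, v; P] := by
    intro u v hu hv
    rw [L2.inner_def, covariance]
    refine integral_congr_ae ?_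
    filter_upwards [hu.coeFn_toLp, hv.coeFn_toLp] with ω h1 h2
    rw [h1, h2]
    simp [mul_comm]
  refine ⟨a, fun j => ?_⟩
  rw [covariance_fun_sub_left hx (memLp_finsetSum _ fun l _ => hsum l) (hy j),
    covariance_fun_sum_left (fun l => hsum l) (hy j)]
  simp_rw [covariance_const_mul_left]
  have h := hinner j
  rw [inner_sub_left, sum_inner] at h
  simp_rw [inner_smul_left, ξ, η, cL] at h
  simpa using h

lemma lintegral_sub_meanVec_le {k : ℕ} {ν : Measure (Vec k)} (hν : ν ∈ P2 k) (q : Vec k) :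
    ∫⁻ r, ‖meanVec ν - r‖ₑ ^ 2 ∂ν ≤ ∫⁻ r, ‖q - r‖ₑ ^ 2 ∂ν := by
  have key : ∀ q : Vec k, ∫⁻ r, ‖q - r‖ₑ ^ 2 ∂ν
      = ENNReal.ofReal (quad (1 : Matrix (Fin k) (Fin k) ℝ) (covMat ν) + ‖meanVec ν - q‖ ^ 2) := by
    intro q
    have := lintegral_enorm_sq_affine hν (1 : Matrix (Fin k) (Fin k) ℝ) (-q)
    have e : ∀ r : Vec k, (1 : Matrix (Fin k) (Fin k) ℝ).toEuclideanLin r = r := by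
      intro r; simp
    simp_rw [e, ← sub_eq_add_neg] at this
    rw [← this]
    exact lintegral_congr fun r => by rw [← enorm_neg, neg_sub]
  rw [key, key]
  refine ENNReal.ofReal_le_ofReal ?_
  simp only [sub_self, norm_zero]
  nlinarith [sq_nonneg ‖meanVec ν - q‖]

/-- For jointly Gaussian `(X, Y)`, some affine estimator of `X` given `Y` beats all estimators. -/
lemma exists_affine_optimal {Ω : Type*} [MeasurableSpace Ω] {P : Measure Ω} {n m : ℕ}
    {X : Ω → Vec n} {Y : Ω → Vec m} (hX : Measurable X) (hY : Measurable Y)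
    (h : HasGaussianLaw (fun ω => (X ω, Y ω)) P) :
    ∃ (A : Matrix (Fin n) (Fin m) ℝ) (c : Vec n), ∀ g : Vec m → Vec n, Measurable g →
      ∫⁻ ω, ‖A.toEuclideanLin (Y ω) + c - X ω‖ₑ ^ 2 ∂P ≤ ∫⁻ ω, ‖g (Y ω) - X ω‖ₑ ^ 2 ∂P := by
  have := h.isProbabilityMeasure
  have hXi : ∀ i, MemLp (fun ω => X ω i) 2 P := fun i =>
    (EuclideanSpace.proj (𝕜 := ℝ) i).comp_memLp' h.fst.memLp_two
  have hYi : ∀ i, MemLp (fun ω => Y ω i) 2 P := fun i =>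
    (EuclideanSpace.proj (𝕜 := ℝ) i).comp_memLp' h.snd.memLp_two
  choose A hA using fun i => exists_regression (hXi i) hYi
  set A' : Matrix (Fin n) (Fin m) ℝ := Matrix.of A with hA'
  set R : Ω → Vec n := fun ω => X ω - A'.toEuclideanLin (Y ω) with hR
  have hRm : Measurable R := by fun_prop
  have hRY : HasGaussianLaw (fun ω => (R ω, Y ω)) P := by
    let L : Vec n × Vec m →L[ℝ] Vec n × Vec m :=
      ((ContinuousLinearMap.fst ℝ _ _) - (LinearMap.toContinuousLinearMap A'.toEuclideanLin) ∘L
        (ContinuousLinearMap.snd ℝ _ _)).prod (ContinuousLinearMap.snd ℝ _ _)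
    exact h.map_fun L
  have hRi : ∀ i, MemLp (fun ω => R ω i) 2 P := fun i =>
    (EuclideanSpace.proj (𝕜 := ℝ) i).comp_memLp' hRY.fst.memLp_two
  -- Uncorrelated and jointly Gaussian, hence independent. Given `Y = y`, an estimator of `R` is
  -- then a constant, and the best constant is the mean of `R`.
  have hind : IndepFun R Y P := by
    refine hRY.indepFun_of_covariance_inner fun u v => ?_
    simp only [PiLp.inner_apply, RCLike.inner_apply, conj_trivial]
    rw [covariance_fun_sum_fun_sum (fun i => (hRi i).mul_const _) (fun i => (hYi i).mul_const _)]
    refine Finset.sum_eq_zero fun i _ => Finset.sum_eq_zero fun j _ => ?_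
    rw [covariance_mul_const_left, covariance_mul_const_right]
    have e : (fun ω => R ω i) = fun ω => X ω i - ∑ l, A i l * Y ω l := by
      ext ω
      simp [hR, hA', toEuclideanLin_coord]
    rw [e, hA i j]
    simp
  have hmap := (indepFun_iff_map_prod_eq_prod_map_map (by fun_prop) (by fun_prop)).1 hind.symm
  have hg := hRY.fst.isGaussian_map
  have := hRY.snd.isGaussian_map
  have hdis : ∀ g : Vec m → Vec n, Measurable g → ∫⁻ ω, ‖g (Y ω) - R ω‖ₑ ^ 2 ∂P
      = ∫⁻ y, ∫⁻ r, ‖g y - r‖ₑ ^ 2 ∂(P.map R) ∂(P.map Y) := by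
    intro g hgm
    rw [← lintegral_prod (f := fun z : Vec m × Vec n => ‖g z.1 - z.2‖ₑ ^ 2)
      (Measurable.aemeasurable (by fun_prop)), ← hmap, lintegral_map (by fun_prop) (by fun_prop)]
  refine ⟨A', meanVec (P.map R), fun g hgm => ?_⟩
  have e1 : ∀ ω, A'.toEuclideanLin (Y ω) + meanVec (P.map R) - X ω
      = (fun _ => meanVec (P.map R)) (Y ω) - R ω := fun ω => by simp only [hR]; abel
  have e2 : ∀ ω, g (Y ω) - X ω = (fun y => g y - A'.toEuclideanLin y) (Y ω) - R ω := fun ω => by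
    simp only [hR]; abel
  simp_rw [e1, e2]
  rw [hdis _ measurable_const, hdis (fun y => g y - A'.toEuclideanLin y) (by fun_prop)]
  exact lintegral_mono fun y => lintegral_sub_meanVec_le (P2_of_isGaussian _) _

lemma mse_eq_lintegral_shift {n m : ℕ} (H : Matrix (Fin m) (Fin n) ℝ) {f : Vec m → Vec n}
    (hf : Measurable f) (μx δx : Vec n) (Sx : Matrix (Fin n) (Fin n) ℝ) (μw δw : Vec m)
    (Sw : Matrix (Fin m) (Fin m) ℝ) :
    mse H f ((multivariateGaussian (μx + δx) Sx).prod (multivariateGaussian (μw + δw) Sw))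
      = ∫⁻ z, ‖f (H.toEuclideanLin (z.1 + δx) + (z.2 + δw)) - (z.1 + δx)‖ₑ ^ 2
        ∂((multivariateGaussian μx Sx).prod (multivariateGaussian μw Sw)) := by
  rw [mse, ← multivariateGaussian_map_add, ← multivariateGaussian_map_add,
    Measure.map_prod_map _ _ (by fun_prop) (by fun_prop), lintegral_map (by fun_prop) (by fun_prop)]
  rfl

/-- The error of any estimator under a Gaussian mixture of shifted product normal distributions
is at least that of some affine estimator. -/
lemma exists_le_lintegral_mse {n m N : ℕ} (H : Matrix (Fin m) (Fin n) ℝ) {f : Vec m → Vec n}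
    (hf : Measurable f) (μx : Vec n) {Sx : Matrix (Fin n) (Fin n) ℝ} (hSx : Sx.PosSemidef)
    (μw : Vec m) {Sw : Matrix (Fin m) (Fin m) ℝ} (hSw : Sw.PosSemidef)
    (Dx : Matrix (Fin n) (Fin N) ℝ) (Dw : Matrix (Fin m) (Fin N) ℝ) :
    ∃ A : Matrix (Fin n) (Fin m) ℝ,
      ENNReal.ofReal (quad (A * H - 1) Sx + quad A Sw + quad ((A * H - 1) * Dx + A * Dw) 1)
        ≤ ∫⁻ g, mse H f ((multivariateGaussian (μx + Dx.toEuclideanLin g) Sx).prod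
          (multivariateGaussian (μw + Dw.toEuclideanLin g) Sw))
            ∂(multivariateGaussian (0 : Vec N) 1) := by
  set γ := multivariateGaussian (0 : Vec N) 1
  set P := γ.prod ((multivariateGaussian μx Sx).prod (multivariateGaussian μw Sw)) with hP
  have hdis : ∀ f : Vec m → Vec n, Measurable f →
      ∫⁻ g, mse H f ((multivariateGaussian (μx + Dx.toEuclideanLin g) Sx).prod
          (multivariateGaussian (μw + Dw.toEuclideanLin g) Sw)) ∂γ
      = ∫⁻ ω, ‖f (H.toEuclideanLin (ω.2.1 + Dx.toEuclideanLin ω.1)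
          + (ω.2.2 + Dw.toEuclideanLin ω.1)) - (ω.2.1 + Dx.toEuclideanLin ω.1)‖ₑ ^ 2 ∂P := by
    intro f hf
    simp_rw [mse_eq_lintegral_shift H hf]
    rw [hP, lintegral_prod _ (Measurable.aemeasurable (by fun_prop))]
  set X : Vec N × (Vec n × Vec m) → Vec n := fun ω => ω.2.1 + Dx.toEuclideanLin ω.1 with hX
  set Y : Vec N × (Vec n × Vec m) → Vec m := fun ω =>
    H.toEuclideanLin (ω.2.1 + Dx.toEuclideanLin ω.1) + (ω.2.2 + Dw.toEuclideanLin ω.1) with hY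
  -- The common shift correlates signal and noise, but `X` and `Y` remain linear images of one
  -- Gaussian vector.
  have hXY : HasGaussianLaw (fun ω => (X ω, Y ω)) P := by
    let l1 : Vec N × (Vec n × Vec m) →L[ℝ] Vec N := ContinuousLinearMap.fst ℝ _ _
    let l2 : Vec N × (Vec n × Vec m) →L[ℝ] Vec n :=
      (ContinuousLinearMap.fst ℝ _ _) ∘L (ContinuousLinearMap.snd ℝ _ _)
    let l3 : Vec N × (Vec n × Vec m) →L[ℝ] Vec m :=
      (ContinuousLinearMap.snd ℝ _ _) ∘L (ContinuousLinearMap.snd ℝ _ _)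
    let LX := l2 + (LinearMap.toContinuousLinearMap Dx.toEuclideanLin) ∘L l1
    let LY := (LinearMap.toContinuousLinearMap H.toEuclideanLin) ∘L LX
      + (l3 + (LinearMap.toContinuousLinearMap Dw.toEuclideanLin) ∘L l1)
    exact (IsGaussian.hasGaussianLaw_id (μ := P)).map_fun (LX.prod LY)
  obtain ⟨A, c, hA⟩ := exists_affine_optimal (by fun_prop) (by fun_prop) hXY
  refine ⟨A, ?_⟩
  have hfm : Measurable fun y : Vec m => A.toEuclideanLin y + c := by fun_prop
  rw [hdis f hf]
  refine le_trans ?_ (hA f hf)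
  rw [← hdis _ hfm]
  have hJ : 0 ≤ quad (A * H - 1) Sx + quad A Sw :=
    add_nonneg (quad_nonneg _ hSx) (quad_nonneg _ hSw)
  have hm : ∀ g : Vec N, mse H (fun y : Vec m => A.toEuclideanLin y + c)
      ((multivariateGaussian (μx + Dx.toEuclideanLin g) Sx).prod
        (multivariateGaussian (μw + Dw.toEuclideanLin g) Sw))
      = ENNReal.ofReal (quad (A * H - 1) Sx + quad A Sw)
        + ‖((A * H - 1) * Dx + A * Dw).toEuclideanLin g
          + ((A * H - 1).toEuclideanLin μx + A.toEuclideanLin μw + c)‖ₑ ^ 2 := by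
    intro g
    rw [mse_affine H A c (fun _ => rfl) (P2_of_isGaussian _) (P2_of_isGaussian _),
      covMat_multivariateGaussian _ hSx, covMat_multivariateGaussian _ hSw,
      meanVec_multivariateGaussian, meanVec_multivariateGaussian, enorm_sq_eq,
      ENNReal.ofReal_add hJ (sq_nonneg _)]
    congr 4
    simp only [map_add, LinearMap.add_apply, Matrix.toLpLin_mul_same, LinearMap.comp_apply]
    abel
  simp_rw [hm]
  rw [lintegral_add_left measurable_const, lintegral_const, measure_univ, mul_one,
    lintegral_enorm_sq_affine (P2_of_isGaussian _), covMat_multivariateGaussian _ PosSemidef.one,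
    ← ENNReal.ofReal_add hJ (add_nonneg (quad_nonneg _ PosSemidef.one) (sq_nonneg _))]
  refine ENNReal.ofReal_le_ofReal ?_
  linarith [sq_nonneg ‖((A * H - 1) * Dx + A * Dw).toEuclideanLin (meanVec γ)
          + ((A * H - 1).toEuclideanLin μx + A.toEuclideanLin μw + c)‖]

/-- The error of any estimator under a product of normal distributions is at least that of some
affine estimator. -/
lemma exists_le_mse {n m : ℕ} (H : Matrix (Fin m) (Fin n) ℝ) {f : Vec m → Vec n}
    (hf : Measurable f) (μx : Vec n) {Sx : Matrix (Fin n) (Fin n) ℝ} (hSx : Sx.PosSemidef)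
    (μw : Vec m) {Sw : Matrix (Fin m) (Fin m) ℝ} (hSw : Sw.PosSemidef) :
    ∃ A : Matrix (Fin n) (Fin m) ℝ, ENNReal.ofReal (quad (A * H - 1) Sx + quad A Sw)
        ≤ mse H f ((multivariateGaussian μx Sx).prod (multivariateGaussian μw Sw)) := by
  obtain ⟨A, hA⟩ := exists_le_lintegral_mse (N := 0) H hf μx hSx μw hSw 0 0
  refine ⟨A, ?_⟩
  simpa [quad, -Matrix.toLpLin_mul_same] using hA

end

/-! ### Trace forms and convexity of the feasible covariances -/

section

variable {d : ℕ}

lemma quad_add {k : ℕ} (K : Matrix (Fin k) (Fin d) ℝ) (S T : Matrix (Fin d) (Fin d) ℝ) :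
    quad K (S + T) = quad K S + quad K T := by
  simp [quad, Matrix.mul_add, Matrix.add_mul]

lemma quad_smul {k : ℕ} (K : Matrix (Fin k) (Fin d) ℝ) (c : ℝ) (S : Matrix (Fin d) (Fin d) ℝ) :
    quad K (c • S) = c * quad K S := by
  simp [quad]

lemma quad_sum {k : ℕ} {ι : Type*} (s : Finset ι) (K : Matrix (Fin k) (Fin d) ℝ)
    (S : ι → Matrix (Fin d) (Fin d) ℝ) : quad K (∑ i ∈ s, S i) = ∑ i ∈ s, quad K (S i) := by
  simp [quad, Matrix.mul_sum, Matrix.sum_mul, Matrix.trace_sum]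

lemma quad_line {k : ℕ} (K L : Matrix (Fin k) (Fin d) ℝ) (S : Matrix (Fin d) (Fin d) ℝ) :
    ∃ l, ∀ s : ℝ, quad (K + s • L) S = quad K S + 2 * s * l + s ^ 2 * quad L S := by
  refine ⟨((K * S * Lᵀ).trace + (L * S * Kᵀ).trace) / 2, fun s => ?_⟩
  simp only [quad, Matrix.transpose_add, Matrix.transpose_smul, Matrix.add_mul, Matrix.mul_add,
    Matrix.smul_mul, Matrix.mul_smul, Matrix.trace_add, Matrix.trace_smul, smul_eq_mul]
  ring

lemma Feas.mono {S₀ S C : Matrix (Fin d) (Fin d) ℝ} {r r' : ℝ} {δ : Vec d}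
    (h : Feas S₀ r δ S C) (hr : r ≤ r') : Feas S₀ r' δ S C :=
  ⟨h.1, h.2.trans hr⟩

lemma Feas.centered {S₀ S C : Matrix (Fin d) (Fin d) ℝ} {r : ℝ} {δ : Vec d}
    (h : Feas S₀ r δ S C) : Feas S₀ (r - ‖δ‖ ^ 2) 0 S C :=
  ⟨h.1, by have := h.2; simp; linarith⟩

lemma Feas.trace_le {S₀ S C : Matrix (Fin d) (Fin d) ℝ} {r : ℝ}
    (h : Feas S₀ r 0 S C) : S.trace + S₀.trace - 2 * C.trace ≤ r := by
  simpa using h.2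

/-- Congruence with `diag(s, 1)`: the first component of the coupling is multiplied by `s`. -/
lemma posSemidef_block_scale {S₀ S C : Matrix (Fin d) (Fin d) ℝ}
    (h : (fromBlocks S C Cᵀ S₀).PosSemidef) (s : ℝ) :
    (fromBlocks (s ^ 2 • S) (s • C) (s • C)ᵀ S₀).PosSemidef := by
  have := h.mul_mul_conjTranspose_same (fromBlocks (s • (1 : Matrix (Fin d) (Fin d) ℝ)) 0 0
    (1 : Matrix (Fin d) (Fin d) ℝ))
  convert this using 1
  rw [fromBlocks_conjTranspose]
  simp [fromBlocks_multiply, smul_smul, pow_two, conjTranspose_eq_transpose_of_trivial]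

lemma feas_self {S₀ : Matrix (Fin d) (Fin d) ℝ} (h : S₀.PosSemidef) : Feas S₀ 0 0 S₀ S₀ := by
  refine ⟨?_, by simp; linarith⟩
  have := h.mul_mul_conjTranspose_same (fromRows (1 : Matrix (Fin d) (Fin d) ℝ)
    (1 : Matrix (Fin d) (Fin d) ℝ))
  convert this using 1
  have hs : S₀ᵀ = S₀ := by
    have := h.1.eq
    rwa [conjTranspose_eq_transpose_of_trivial] at this
  ext i j
  rcases i with i | i <;> rcases j with j | j <;>
    simp [fromRows_mul, conjTranspose_eq_transpose_of_trivial, hs, mul_apply, one_apply]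

lemma Feas.combine {S₀ S C S' C' : Matrix (Fin d) (Fin d) ℝ} {r r' : ℝ}
    (h : Feas S₀ r 0 S C) (h' : Feas S₀ r' 0 S' C') {t : ℝ} (h0 : 0 ≤ t) (h1 : t ≤ 1)
    (δ : Vec d) :
    Feas S₀ (t * r + (1 - t) * r' + ‖δ‖ ^ 2) δ (t • S + (1 - t) • S') (t • C + (1 - t) • C') := by
  constructor
  · have e : fromBlocks (t • S + (1 - t) • S') (t • C + (1 - t) • C') (t • C + (1 - t) • C')ᵀ S₀
        = t • fromBlocks S C Cᵀ S₀ + (1 - t) • fromBlocks S' C' C'ᵀ S₀ := by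
      rw [fromBlocks_smul, fromBlocks_smul, fromBlocks_add]
      simp [← add_smul]
    rw [e]
    exact (h.1.smul h0).add (h'.1.smul (by linarith))
  · have a := mul_le_mul_of_nonneg_left h.trace_le h0
    have b := mul_le_mul_of_nonneg_left h'.trace_le (sub_nonneg.2 h1)
    simp only [Matrix.trace_add, Matrix.trace_smul, smul_eq_mul]
    linarith

lemma feas_sum {ι : Type*} (s : Finset ι) {S₀ : Matrix (Fin d) (Fin d) ℝ}
    {S C : ι → Matrix (Fin d) (Fin d) ℝ} {r p : ι → ℝ} (h : ∀ i, Feas S₀ (r i) 0 (S i) (C i))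
    (hp : ∀ i, 0 ≤ p i) (hp1 : ∑ i ∈ s, p i = 1) :
    Feas S₀ (∑ i ∈ s, p i * r i) 0 (∑ i ∈ s, p i • S i) (∑ i ∈ s, p i • C i) := by
  constructor
  · have e : fromBlocks (∑ i ∈ s, p i • S i) (∑ i ∈ s, p i • C i) (∑ i ∈ s, p i • C i)ᵀ S₀
        = ∑ i ∈ s, p i • fromBlocks (S i) (C i) (C i)ᵀ S₀ := by
      ext a b
      rcases a with a | a <;> rcases b with b | b <;>
        simp [Matrix.sum_apply, ← Finset.sum_mul, hp1]
    rw [e]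
    exact posSemidef_sum s fun i _ => (h i).1.smul (hp i)
  · have a : ∑ i ∈ s, p i * ((S i).trace + S₀.trace - 2 * (C i).trace) ≤ ∑ i ∈ s, p i * r i :=
      Finset.sum_le_sum fun i _ => mul_le_mul_of_nonneg_left (h i).trace_le (hp i)
    refine le_trans (le_of_eq ?_) a
    simp only [Matrix.trace_sum, Matrix.trace_smul, smul_eq_mul, mul_sub, mul_add,
      Finset.sum_sub_distrib, Finset.sum_add_distrib, ← Finset.sum_mul, hp1, Finset.mul_sum]
    simp only [norm_zero]
    have : ∀ i, 2 * (p i * (C i).trace) = p i * (2 * (C i).trace) := fun i => by ring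
    simp_rw [this]
    ring

/-- A nonnegative function that is a quadratic polynomial along every line. -/
def IsNonnegQuadratic {V : Type*} [AddCommGroup V] [Module ℝ V] (q : V → ℝ) : Prop :=
  (∀ A, 0 ≤ q A) ∧ ∀ A B, ∃ l m, 0 ≤ m ∧ ∀ s : ℝ, q (A + s • B) = q A + 2 * s * l + s ^ 2 * m

lemma linear_coeff_eq_zero {l m : ℝ} (h : ∀ s : ℝ, 0 ≤ 2 * s * l + s ^ 2 * m) : l = 0 := by
  by_contra hl
  have hm : 0 ≤ m := by nlinarith [h 1, h (-1)]
  -- Dividing by `m + 1` instead of `m` also covers `m = 0`.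
  have h1 := h (-l / (m + 1))
  have e : 2 * (-l / (m + 1)) * l + (-l / (m + 1)) ^ 2 * m = -(l ^ 2 * (m + 2)) / (m + 1) ^ 2 := by
    field_simp
    ring
  rw [e] at h1
  have : -(l ^ 2 * (m + 2)) / (m + 1) ^ 2 < 0 := by
    apply div_neg_of_neg_of_pos
    · have : 0 < l ^ 2 := by positivity
      nlinarith
    · positivity
  linarith

/-! ### Minimisers of a sum of two quadratics, and the response to a change of budget -/

section Minimizer

variable {V : Type*} [AddCommGroup V] [Module ℝ V] {q₁ q₂ : V → ℝ} {A₀ : V}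

/-- Stationarity of the sum at `A₀` forces the first-order coefficients of `q₁` and `q₂` towards `A`
to be opposite. -/
lemma exists_line_coeffs (h₁ : IsNonnegQuadratic q₁) (h₂ : IsNonnegQuadratic q₂)
    (hmin : ∀ A, q₁ A₀ + q₂ A₀ ≤ q₁ A + q₂ A) (A : V) :
    ∃ l m m', 0 ≤ m ∧ 0 ≤ m' ∧ q₁ A = q₁ A₀ + 2 * l + m ∧ q₂ A = q₂ A₀ - 2 * l + m' ∧
      ∀ s : ℝ, 0 ≤ q₁ A₀ + 2 * s * l + s ^ 2 * m := by
  obtain ⟨l, m, hm, h⟩ := h₁.2 A₀ (A - A₀)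
  obtain ⟨l', m', hm', h'⟩ := h₂.2 A₀ (A - A₀)
  have hl : l + l' = 0 := linear_coeff_eq_zero (m := m + m') fun s => by
    have := hmin (A₀ + s • (A - A₀))
    rw [h, h'] at this
    linarith
  refine ⟨l, m, m', hm, hm', ?_, ?_, fun s => ?_⟩
  · have := h 1
    rw [one_smul, add_sub_cancel] at this
    linarith
  · have := h' 1
    rw [one_smul, add_sub_cancel] at this
    linarith
  · rw [← h]
    exact h₁.1 _

/-- Nonnegativity of `q₁` at the parameter `α / (α - 1)` of the line from `A₀` to `A`, multiplied by
`(α - 1)²`, controls the unknown slope `l`. The resulting gain is of first order in `α - 1` when `q₁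
A₀ > 0`. -/
lemma le_of_scale (h₁ : IsNonnegQuadratic q₁) (h₂ : IsNonnegQuadratic q₂)
    (hmin : ∀ A, q₁ A₀ + q₂ A₀ ≤ q₁ A + q₂ A) (A : V) {α : ℝ} (hα : 0 < α) :
    q₁ A₀ + q₂ A₀ + q₁ A₀ * (1 - 1 / α) ≤ α * q₁ A + q₂ A := by
  obtain ⟨l, m, m', hm, hm', e₁, e₂, hs⟩ := exists_line_coeffs h₁ h₂ hmin A
  have key : 0 ≤ q₁ A₀ * (α - 1) ^ 2 + 2 * (α - 1) * α * l + α ^ 2 * m := by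
    rcases eq_or_ne α 1 with rfl | hne
    · simpa using hm
    · have hne' : α - 1 ≠ 0 := sub_ne_zero.2 hne
      have := mul_nonneg (sq_nonneg (α - 1)) (hs (α / (α - 1)))
      have e : (α - 1) ^ 2 * (q₁ A₀ + 2 * (α / (α - 1)) * l + (α / (α - 1)) ^ 2 * m)
          = q₁ A₀ * (α - 1) ^ 2 + 2 * (α - 1) * α * l + α ^ 2 * m := by
        field_simp
      rwa [e] at this
  have e : α * q₁ A + q₂ A - (q₁ A₀ + q₂ A₀ + q₁ A₀ * (1 - 1 / α))
      = (q₁ A₀ * (α - 1) ^ 2 + 2 * (α - 1) * α * l + α ^ 2 * m) / α + m' := by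
    rw [e₁, e₂]
    field_simp
    ring
  have := div_nonneg key hα.le
  linarith

/-- A zero of the nonnegative `q₁` is stationary for `q₁`, hence also for `q₂`, and convexity does
the rest. -/
lemma le_of_eq_zero (h₁ : IsNonnegQuadratic q₁) (h₂ : IsNonnegQuadratic q₂)
    (hmin : ∀ A, q₁ A₀ + q₂ A₀ ≤ q₁ A + q₂ A) (hk : q₁ A₀ = 0) (A : V) : q₂ A₀ ≤ q₂ A := by
  obtain ⟨l, m, m', hm, hm', e₁, e₂, hs⟩ := exists_line_coeffs h₁ h₂ hmin A
  have : l = 0 := linear_coeff_eq_zero (m := m) fun s => by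
    have := hs s
    rw [hk] at this
    linarith
  rw [e₂, this]
  linarith

end Minimizer

lemma quad_isNonnegQuadratic {n m : ℕ} {S : Matrix (Fin m) (Fin m) ℝ} (hS : S.PosSemidef) :
    IsNonnegQuadratic fun A : Matrix (Fin n) (Fin m) ℝ => quad A S := by
  refine ⟨fun A => quad_nonneg A hS, fun A B => ?_⟩
  obtain ⟨l, h⟩ := quad_line A B S
  exact ⟨l, quad B S, quad_nonneg _ hS, h⟩

lemma quad_comp_isNonnegQuadratic {n m : ℕ} (H : Matrix (Fin m) (Fin n) ℝ)
    {S : Matrix (Fin n) (Fin n) ℝ} (hS : S.PosSemidef) :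
    IsNonnegQuadratic fun A : Matrix (Fin n) (Fin m) ℝ => quad (A * H - 1) S := by
  refine ⟨fun A => quad_nonneg _ hS, fun A B => ?_⟩
  obtain ⟨l, h⟩ := quad_line (A * H - 1) (B * H) S
  refine ⟨l, quad (B * H) S, quad_nonneg _ hS, fun s => ?_⟩
  have e : (A + s • B) * H - 1 = (A * H - 1) + s • (B * H) := by
    rw [Matrix.add_mul, Matrix.smul_mul]
    abel
  simp only [e, h]

lemma abs_scaling_le {κ η b τ : ℝ} (hκ : 0 < κ) (hb : 0 ≤ b) (hη : |η| * (2 * κ * b) ≤ 1)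
    (hτ : τ = η / (2 * κ) - b * η ^ 2) : |τ| ≤ |η| / κ := by
  have h1 : |τ| ≤ |η / (2 * κ)| + |b * η ^ 2| := by rw [hτ]; exact abs_sub _ _
  rw [abs_div, abs_of_pos (by positivity : (0 : ℝ) < 2 * κ), abs_mul, abs_of_nonneg hb,
    abs_pow] at h1
  have h2 : b * |η| ^ 2 ≤ |η| / (2 * κ) := by
    rw [le_div_iff₀ (by positivity)]
    have : b * |η| ^ 2 * (2 * κ) = |η| * (|η| * (2 * κ * b)) := by ring
    rw [this]
    exact mul_le_of_le_one_right (abs_nonneg η) hη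
  have h3 : |η| / (2 * κ) + |η| / (2 * κ) = |η| / κ := by field_simp; norm_num
  linarith

/-- The correction `b η²` pays for the quadratic cost: `2 τ κ = η - μ η² / κ²`, while `τ² μ ≤ μ η² /
κ²`. -/
lemma scaling_bounds {κ μ η b τ : ℝ} (hκ : 0 < κ) (hμ : 0 ≤ μ) (hb : b = μ / (2 * κ ^ 3))
    (hτ : τ = η / (2 * κ) - b * η ^ 2) (hle : |τ| ≤ |η| / κ) :
    2 * τ * κ + τ ^ 2 * μ ≤ η ∧
      η / κ - (2 * b + 4 / κ ^ 2) * η ^ 2 ≤ 2 * τ - 4 * τ ^ 2 := by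
  have hτsq : τ ^ 2 ≤ η ^ 2 / κ ^ 2 := by
    rw [← sq_abs τ, ← sq_abs η, ← div_pow]
    exact pow_le_pow_left₀ (abs_nonneg _) hle 2
  constructor
  · have h1 : τ ^ 2 * μ ≤ η ^ 2 / κ ^ 2 * μ := mul_le_mul_of_nonneg_right hτsq hμ
    have h2 : 2 * τ * κ = η - η ^ 2 / κ ^ 2 * μ := by
      subst hτ hb
      field_simp
    linarith
  · have : η / κ - (2 * b + 4 / κ ^ 2) * η ^ 2 = 2 * τ - 4 * (η ^ 2 / κ ^ 2) := by
      subst hτ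
      field_simp
      ring
    rw [this]
    linarith

/-- A change `η` of the budget is realised by a scaling parameter `τ` up to second order. -/
lemma exists_scaling {κ μ : ℝ} (hκ : 0 < κ) (hμ : 0 ≤ μ) :
    ∃ c h, 0 ≤ c ∧ 0 < h ∧ ∀ η : ℝ, |η| ≤ h → ∃ τ : ℝ, |τ| ≤ 1 / 8 ∧
      2 * τ * κ + τ ^ 2 * μ ≤ η ∧ η / κ - c * η ^ 2 ≤ 2 * τ - 4 * τ ^ 2 := by
  obtain ⟨b, hb⟩ : ∃ b, b = μ / (2 * κ ^ 3) := ⟨_, rfl⟩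
  have hb0 : 0 ≤ b := by rw [hb]; positivity
  refine ⟨2 * b + 4 / κ ^ 2, min (κ / 8) (1 / (2 * κ * (b + 1))), by positivity,
    lt_min (by positivity) (by positivity), fun η hη => ?_⟩
  have hη1 : |η| ≤ κ / 8 := hη.trans (min_le_left _ _)
  have hη2 : |η| * (2 * κ * b) ≤ 1 := by
    have h := hη.trans (min_le_right _ _)
    rw [le_div_iff₀ (by positivity)] at h
    have e : |η| * (2 * κ * (b + 1)) = |η| * (2 * κ * b) + |η| * (2 * κ) := by ring
    have : 0 ≤ |η| * (2 * κ) := mul_nonneg (abs_nonneg η) (by positivity)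
    linarith
  obtain ⟨τ, hτ⟩ : ∃ τ, τ = η / (2 * κ) - b * η ^ 2 := ⟨_, rfl⟩
  have hτabs := abs_scaling_le hκ hb0 hη2 hτ
  exact ⟨τ, hτabs.trans (by rw [div_le_iff₀ hκ]; linarith), scaling_bounds hκ hμ hb hτ hτabs⟩

lemma one_sub_inv_sq_ge {τ : ℝ} (hτ : |τ| ≤ 1 / 8) :
    2 * τ - 4 * τ ^ 2 ≤ 1 - 1 / (1 + τ) ^ 2 := by
  have hτl := neg_le_of_abs_le hτ
  have hpos : 0 < (1 + τ) ^ 2 := pow_pos (by linarith) 2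
  rw [le_sub_comm, div_le_iff₀ hpos]
  have e : (1 - (2 * τ - 4 * τ ^ 2)) * (1 + τ) ^ 2 = 1 + τ ^ 2 * (1 + 6 * τ + 4 * τ ^ 2) := by
    ring
  have : 0 ≤ τ ^ 2 * (1 + 6 * τ + 4 * τ ^ 2) :=
    mul_nonneg (sq_nonneg _) (by linarith [sq_nonneg τ])
  rw [e]
  linarith

lemma Feas.scale {S₀ S C : Matrix (Fin d) (Fin d) ℝ} {r : ℝ} (hF : Feas S₀ r 0 S C) (τ : ℝ) :
    Feas S₀ (r + 2 * τ * (S.trace - C.trace) + τ ^ 2 * S.trace) 0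
      ((1 + τ) ^ 2 • S) ((1 + τ) • C) := by
  refine ⟨posSemidef_block_scale hF.1 _, ?_⟩
  have := hF.trace_le
  simp only [norm_zero, Matrix.trace_smul, smul_eq_mul]
  linarith

section Path

variable {V : Type*} [AddCommGroup V] [Module ℝ V] {k : ℕ} {Φ : V → Matrix (Fin k) (Fin d) ℝ}
  {q₂ : V → ℝ} {S₀ S C : Matrix (Fin d) (Fin d) ℝ} {r : ℝ} {A₀ : V}

lemma le_quad_scale (h₁ : IsNonnegQuadratic fun A => quad (Φ A) S) (h₂ : IsNonnegQuadratic q₂)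
    (hmin : ∀ A, quad (Φ A₀) S + q₂ A₀ ≤ quad (Φ A) S + q₂ A) (A : V) {s : ℝ} (hs : 0 < s) :
    quad (Φ A₀) S + q₂ A₀ + quad (Φ A₀) S * (1 - 1 / s ^ 2) ≤ quad (Φ A) (s ^ 2 • S) + q₂ A := by
  rw [quad_smul]
  exact le_of_scale h₁ h₂ hmin A (by positivity)

/-- If the error of `A₀` responds to `S`, the cost increases when a least favourable `S` is
scaled up. -/
lemma trace_sub_pos (hr : 0 < r) (hS₀ : S₀.PosSemidef) (hF : Feas S₀ r 0 S C)
    (h₁ : IsNonnegQuadratic fun A => quad (Φ A) S) (h₂ : IsNonnegQuadratic q₂)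
    (hmin : ∀ A, quad (Φ A₀) S + q₂ A₀ ≤ quad (Φ A) S + q₂ A)
    (hval : ∀ S' C', Feas S₀ r 0 S' C' → ∃ A, quad (Φ A) S' + q₂ A ≤ quad (Φ A₀) S + q₂ A₀)
    (hkpos : 0 < quad (Φ A₀) S) : 0 < S.trace - C.trace := by
  have hμ0 : 0 ≤ S.trace := hF.posSemidef.trace_nonneg
  have hq0 := h₂.1 A₀
  -- If `tr S ≤ tr C`, scaling `S` by `(1 + τ)²` costs at most `τ² tr S` more, yet raises the least
  -- error by at least `quad (Φ A₀) S * τ`. Mixing with the zero-cost `S₀` restores the budget at a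
  -- loss of order `τ²`, so small `τ` contradicts `hval`.
  by_contra hneg
  push Not at hneg
  have hlow : ∀ τ : ℝ, 0 < τ → τ ≤ 1 / 2 → ∀ A, quad (Φ A₀) S + q₂ A₀ + quad (Φ A₀) S * τ
      ≤ quad (Φ A) ((1 + τ) ^ 2 • S) + q₂ A := by
    intro τ hτ hτ1 A
    have h3 := le_quad_scale h₁ h₂ hmin A (s := 1 + τ) (by linarith)
    have h4 : τ ≤ 1 - 1 / (1 + τ) ^ 2 := by
      rw [le_sub_comm, div_le_iff₀ (by positivity)]
      have e : (1 - τ) * (1 + τ) ^ 2 = 1 + τ * (1 - τ - τ ^ 2) := by ring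
      have : 0 ≤ τ * (1 - τ - τ ^ 2) := mul_nonneg hτ.le (by nlinarith)
      linarith
    have h5 := mul_le_mul_of_nonneg_left h4 hkpos.le
    linarith
  have hcost : ∀ τ : ℝ, 0 < τ →
      Feas S₀ (r + τ ^ 2 * S.trace) 0 ((1 + τ) ^ 2 • S) ((1 + τ) • C) := fun τ hτ =>
    (hF.scale τ).mono (by nlinarith)
  generalize quad (Φ A₀) S = k at *
  generalize S.trace = μ at *
  obtain ⟨v, hv⟩ : ∃ v, v = k + q₂ A₀ := ⟨_, rfl⟩
  rw [← hv] at hlow hval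
  have hv0 : 0 ≤ v := by linarith
  have key : ∀ τ : ℝ, 0 < τ → τ ≤ 1 / 2 → k * r ≤ τ * μ * v := by
    intro τ hτ hτ1
    have hden : 0 < r + τ ^ 2 * μ := by positivity
    obtain ⟨t, ht⟩ : ∃ t, t = r / (r + τ ^ 2 * μ) := ⟨_, rfl⟩
    have ht0 : 0 ≤ t := by rw [ht]; positivity
    have ht1 : t ≤ 1 := by
      rw [ht, div_le_one hden]
      linarith [mul_nonneg (sq_nonneg τ) hμ0]
    have hcomb := (hcost τ hτ).combine (feas_self hS₀) ht0 ht1 0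
    have e : t * (r + τ ^ 2 * μ) + (1 - t) * 0 + ‖(0 : Vec d)‖ ^ 2 = r := by
      rw [ht]
      simp only [norm_zero]
      field_simp
      ring
    rw [e] at hcomb
    obtain ⟨A, hA⟩ := hval _ _ hcomb
    rw [quad_add, quad_smul _ t, quad_smul _ (1 - t)] at hA
    have h6 : 0 ≤ (1 - t) * quad (Φ A) S₀ := mul_nonneg (by linarith) (quad_nonneg _ hS₀)
    have h7 : 0 ≤ (1 - t) * q₂ A := mul_nonneg (by linarith) (h₂.1 A)
    have h8 : t * (v + k * τ) ≤ v := by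
      have := mul_le_mul_of_nonneg_left (hlow τ hτ hτ1 A) ht0
      linarith
    rw [ht, div_mul_eq_mul_div, div_le_iff₀ hden] at h8
    have h9 : τ * (k * r) ≤ τ * (τ * μ * v) := by linarith
    exact le_of_mul_le_mul_left h9 hτ
  have hkr : 0 < k * r := by positivity
  have hμv : 0 ≤ μ * v := mul_nonneg hμ0 hv0
  -- The `τ` built on this denominator is at most `1 / 2` and small enough to violate `key`.
  have hden : 0 < 2 * (μ * v + k * r) + 1 := by positivity
  have := key (k * r / (2 * (μ * v + k * r) + 1)) (by positivity) (by
    rw [div_le_div_iff₀ hden (by norm_num)]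
    linarith)
  have e : k * r / (2 * (μ * v + k * r) + 1) * μ * v
      = k * r * (μ * v) / (2 * (μ * v + k * r) + 1) := by ring
  rw [e, le_div_iff₀ hden] at this
  have := le_of_mul_le_mul_left this hkr
  linarith

/-- At a least favourable `S`, a small change `η` of the cost budget can be answered by a change of
the covariance that moves the least error by `Λ η` up to second order. -/
lemma exists_path (hr : 0 < r) (hS₀ : S₀.PosSemidef) (hF : Feas S₀ r 0 S C)
    (h₁ : IsNonnegQuadratic fun A => quad (Φ A) S) (h₂ : IsNonnegQuadratic q₂)
    (hmin : ∀ A, quad (Φ A₀) S + q₂ A₀ ≤ quad (Φ A) S + q₂ A)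
    (hval : ∀ S' C', Feas S₀ r 0 S' C' → ∃ A, quad (Φ A) S' + q₂ A ≤ quad (Φ A₀) S + q₂ A₀) :
    ∃ Λ c h, 0 ≤ Λ ∧ 0 ≤ c ∧ 0 < h ∧ ∀ η : ℝ, |η| ≤ h → ∃ S' C', Feas S₀ (r + η) 0 S' C' ∧
      ∀ A, quad (Φ A₀) S + q₂ A₀ + Λ * η - c * η ^ 2 ≤ quad (Φ A) S' + q₂ A := by
  rcases (quad_nonneg (Φ A₀) hF.posSemidef).eq_or_lt with hk0 | hkpos
  -- Here `A₀` minimises `q₂` alone, so the zero-cost `S₀` serves for every budget `r + η ≥ 0`, with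
  -- slope `0`.
  · refine ⟨0, 0, r, le_rfl, le_rfl, hr, fun η hη => ⟨S₀, S₀, ?_, fun A => ?_⟩⟩
    · exact (feas_self hS₀).mono (by linarith [neg_le_of_abs_le hη])
    · have := le_of_eq_zero h₁ h₂ hmin hk0.symm A
      have := quad_nonneg (Φ A) hS₀
      linarith
  have hκ := trace_sub_pos hr hS₀ hF h₁ h₂ hmin hval hkpos
  obtain ⟨c, h, hc, hh, hη⟩ := exists_scaling hκ hF.posSemidef.trace_nonneg
  refine ⟨quad (Φ A₀) S / (S.trace - C.trace), quad (Φ A₀) S * c, h, by positivity, by positivity,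
    hh, fun η hle => ?_⟩
  obtain ⟨τ, hτ, h3, h4⟩ := hη η hle
  refine ⟨_, _, (hF.scale τ).mono (by linarith), fun A => ?_⟩
  have h5 := le_quad_scale h₁ h₂ hmin A (s := 1 + τ) (by linarith [neg_le_of_abs_le hτ])
  have h6 := mul_le_mul_of_nonneg_left (h4.trans (one_sub_inv_sq_ge hτ)) hkpos.le
  have e : quad (Φ A₀) S * (η / (S.trace - C.trace) - c * η ^ 2)
      = quad (Φ A₀) S / (S.trace - C.trace) * η - quad (Φ A₀) S * c * η ^ 2 := by ring
  linarith

end Path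

end

/-! ### Compensating budget excesses by mixtures -/

section

variable {d n m : ℕ}

lemma Feas.nonneg {S₀ S C : Matrix (Fin d) (Fin d) ℝ} {r : ℝ} {δ : Vec d}
    (h : Feas S₀ r δ S C) : 0 ≤ r := by
  have key : ∀ i, 0 ≤ S i i + S₀ i i - 2 * C i i := by
    intro i
    have := (Matrix.posSemidef_iff_dotProduct_mulVec.1 h.1).2
      (Sum.elim (Pi.single i 1) (Pi.single i (-1)))
    simp [fromBlocks_mulVec, dotProduct_add, mulVec_single] at this
    linarith
  have h1 := Finset.sum_nonneg fun i (_ : i ∈ Finset.univ) => key i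
  have h2 := h.2
  simp only [Finset.sum_sub_distrib, Finset.sum_add_distrib, ← Finset.mul_sum] at h1
  simp only [Matrix.trace, diag_apply] at h2
  linarith [sq_nonneg ‖δ‖]

lemma ofReal_smul_add_isProbabilityMeasure {Ω : Type*} [MeasurableSpace Ω] {P P' : Measure Ω}
    [IsProbabilityMeasure P] [IsProbabilityMeasure P'] {a b : ℝ} (ha : 0 ≤ a) (hb : 0 ≤ b)
    (hab : a + b = 1) : IsProbabilityMeasure (ENNReal.ofReal a • P + ENNReal.ofReal b • P') :=
  ⟨by simp [← ENNReal.ofReal_add ha hb, hab]⟩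

lemma Near.mix {P₀ P P' : Measure (Vec d)} {c c' a b : ℝ} (h : Near P₀ c P) (h' : Near P₀ c' P')
    (hc : 0 ≤ c) (hc' : 0 ≤ c') (ha : 0 ≤ a) (hb : 0 ≤ b) (hab : a + b = 1) :
    Near P₀ (a * c + b * c') (ENNReal.ofReal a • P + ENNReal.ofReal b • P') := by
  obtain ⟨⟨hP, hP2⟩, π, ⟨h1, h2⟩, hπ⟩ := h
  obtain ⟨⟨hP', hP2'⟩, π', ⟨h1', h2'⟩, hπ'⟩ := h'
  refine ⟨⟨ofReal_smul_add_isProbabilityMeasure ha hb hab, ?_⟩,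
    ENNReal.ofReal a • π + ENNReal.ofReal b • π', ⟨?_, ?_⟩, ?_⟩
  · rw [lintegral_add_measure, lintegral_smul_measure, lintegral_smul_measure]
    exact ENNReal.add_lt_top.2 ⟨ENNReal.mul_lt_top ENNReal.ofReal_lt_top hP2,
      ENNReal.mul_lt_top ENNReal.ofReal_lt_top hP2'⟩
  · rw [Measure.map_add _ _ measurable_fst, Measure.map_smul, Measure.map_smul, h1, h1']
  · rw [Measure.map_add _ _ measurable_snd, Measure.map_smul, Measure.map_smul, h2, h2',
      ← add_smul, ← ENNReal.ofReal_add ha hb, hab, ENNReal.ofReal_one, one_smul]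
  · rw [lintegral_add_measure, lintegral_smul_measure, lintegral_smul_measure,
      ENNReal.ofReal_add (mul_nonneg ha hc) (mul_nonneg hb hc'), ENNReal.ofReal_mul ha,
      ENNReal.ofReal_mul hb]
    simp only [smul_eq_mul]
    gcongr

/-- The product of two mixtures has four terms. The one with both compensators, `P'` and `Q'`, is
dropped: in the application its weight is of second order. -/
lemma mse_mix_ge (H : Matrix (Fin m) (Fin n) ℝ) (f : Vec m → Vec n) {P P' : Measure (Vec n)}
    {Q Q' : Measure (Vec m)} [IsProbabilityMeasure P] [IsProbabilityMeasure P']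
    [IsProbabilityMeasure Q] [IsProbabilityMeasure Q'] {a b a' b' : ℝ} (ha : 0 ≤ a) (hb : 0 ≤ b) :
    ENNReal.ofReal (a * a') * mse H f (P.prod Q) + ENNReal.ofReal (b * a') * mse H f (P'.prod Q)
        + ENNReal.ofReal (a * b') * mse H f (P.prod Q')
      ≤ mse H f ((ENNReal.ofReal a • P + ENNReal.ofReal b • P').prod
          (ENNReal.ofReal a' • Q + ENNReal.ofReal b' • Q')) := by
  have i1 : IsFiniteMeasure (ENNReal.ofReal a • P) := Measure.smul_finite _ ENNReal.ofReal_ne_top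
  have i2 : IsFiniteMeasure (ENNReal.ofReal b • P') := Measure.smul_finite _ ENNReal.ofReal_ne_top
  have i3 : IsFiniteMeasure (ENNReal.ofReal a' • Q) := Measure.smul_finite _ ENNReal.ofReal_ne_top
  have i4 : IsFiniteMeasure (ENNReal.ofReal b' • Q') := Measure.smul_finite _ ENNReal.ofReal_ne_top
  unfold mse
  rw [Measure.prod_add, Measure.add_prod, Measure.add_prod]
  simp only [Measure.prod_smul_left, Measure.prod_smul_right, lintegral_add_measure,
    lintegral_smul_measure, smul_eq_mul]
  rw [ENNReal.ofReal_mul ha, ENNReal.ofReal_mul hb, ENNReal.ofReal_mul ha]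
  refine le_trans ?_ (add_le_add_right (le_add_of_nonneg_right zero_le) _)
  refine le_of_eq ?_
  ring

/-- If `f` has error at most `v` on the ball, its error at a pair of distributions that violate the
cost budgets is bounded by means of distributions that compensate for the violation. -/
lemma mse_le_of_compensate {H : Matrix (Fin m) (Fin n) ℝ} {f : Vec m → Vec n} {v : ℝ}
    {Px₀ : Measure (Vec n)} {Pw₀ : Measure (Vec m)} {rx rw : ℝ} (hv : 0 ≤ v)
    (hball : ∀ Px Pw, Near Px₀ rx Px → Near Pw₀ rw Pw → mse H f (Px.prod Pw) ≤ ENNReal.ofReal v)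
    {P P' : Measure (Vec n)} {Q Q' : Measure (Vec m)} {cx cx' cw cw' ox ow lx lw : ℝ}
    (hP : Near Px₀ cx P) (hP' : Near Px₀ cx' P') (hQ : Near Pw₀ cw Q) (hQ' : Near Pw₀ cw' Q')
    (hcx : 0 ≤ cx) (hcx' : 0 ≤ cx') (hcw : 0 ≤ cw) (hcw' : 0 ≤ cw') (hox : 0 ≤ ox) (how : 0 ≤ ow)
    (hbx : cx + ox * cx' = (1 + ox) * rx) (hbw : cw + ow * cw' = (1 + ow) * rw)
    (hlx : ENNReal.ofReal lx ≤ mse H f (P'.prod Q))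
    (hlw : ENNReal.ofReal lw ≤ mse H f (P.prod Q')) :
    0 ≤ v * ((1 + ox) * (1 + ow)) - ox * lx - ow * lw ∧
    mse H f (P.prod Q) ≤ ENNReal.ofReal (v * ((1 + ox) * (1 + ow)) - ox * lx - ow * lw) := by
  have hx1 : 0 < 1 + ox := by linarith
  have hw1 : 0 < 1 + ow := by linarith
  have := hP.1.1
  have := hP'.1.1
  have := hQ.1.1
  have := hQ'.1.1
  have nx := hP.mix hP' hcx hcx' (a := 1 / (1 + ox)) (b := ox / (1 + ox)) (by positivity)
    (by positivity) (by field_simp)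
  have nw := hQ.mix hQ' hcw hcw' (a := 1 / (1 + ow)) (b := ow / (1 + ow)) (by positivity)
    (by positivity) (by field_simp)
  have ex : 1 / (1 + ox) * cx + ox / (1 + ox) * cx' = rx := by
    field_simp
    linarith
  have ew : 1 / (1 + ow) * cw + ow / (1 + ow) * cw' = rw := by
    field_simp
    linarith
  rw [ex] at nx
  rw [ew] at nw
  have hmix := (mse_mix_ge H f (P := P) (P' := P') (Q := Q) (Q' := Q') (a := 1 / (1 + ox))
    (b := ox / (1 + ox)) (a' := 1 / (1 + ow)) (b' := ow / (1 + ow)) (by positivity)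
    (by positivity)).trans (hball _ _ nx nw)
  have hA : 0 < 1 / (1 + ox) * (1 / (1 + ow)) := by positivity
  have hB : 0 ≤ ox / (1 + ox) * (1 / (1 + ow)) := by positivity
  have hC : 0 ≤ 1 / (1 + ox) * (ow / (1 + ow)) := by positivity
  have h2 : ENNReal.ofReal (1 / (1 + ox) * (1 / (1 + ow))) * mse H f (P.prod Q)
      + ENNReal.ofReal (ox / (1 + ox) * (1 / (1 + ow)) * lx)
      + ENNReal.ofReal (1 / (1 + ox) * (ow / (1 + ow)) * lw) ≤ ENNReal.ofReal v := by
    refine le_trans ?_ hmix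
    rw [ENNReal.ofReal_mul hB, ENNReal.ofReal_mul hC]
    gcongr
  have hfin : mse H f (P.prod Q) ≠ ∞ := by
    intro htop
    rw [htop, ENNReal.mul_top (by simpa using hA)] at h2
    simp at h2
  obtain ⟨M, hM, hMeq⟩ : ∃ M : ℝ, 0 ≤ M ∧ mse H f (P.prod Q) = ENNReal.ofReal M :=
    ⟨_, ENNReal.toReal_nonneg, (ENNReal.ofReal_toReal hfin).symm⟩
  rw [hMeq, ← ENNReal.ofReal_mul hA.le] at h2
  have h3 : 1 / (1 + ox) * (1 / (1 + ow)) * M + ox / (1 + ox) * (1 / (1 + ow)) * lx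
      + 1 / (1 + ox) * (ow / (1 + ow)) * lw ≤ v := by
    have h4 := (ENNReal.ofReal_add_le.trans (add_le_add_left ENNReal.ofReal_add_le _)).trans h2
    exact (ENNReal.ofReal_le_ofReal_iff hv).1 h4
  have h5 : M ≤ v * ((1 + ox) * (1 + ow)) - ox * lx - ow * lw := by
    have e : 1 / (1 + ox) * (1 / (1 + ow)) * M + ox / (1 + ox) * (1 / (1 + ow)) * lx
      + 1 / (1 + ox) * (ow / (1 + ow)) * lw = (M + ox * lx + ow * lw) / ((1 + ox) * (1 + ow)) := by
      field_simp
    rw [e, div_le_iff₀ (by positivity)] at h3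
    linarith
  exact ⟨hM.trans h5, by rw [hMeq]; exact ENNReal.ofReal_le_ofReal h5⟩

/-- A small change `η` of the cost budget can be answered by a change of the covariance matrix that
raises the error of every linear estimator to `v + Λ η` up to second order. -/
def HasPath {V : Type*} (S₀ : Matrix (Fin d) (Fin d) ℝ) (r v Λ c h : ℝ)
    (J : Matrix (Fin d) (Fin d) ℝ → V → ℝ) : Prop :=
  ∀ η : ℝ, |η| ≤ h → ∃ S C, Feas S₀ (r + η) 0 S C ∧ ∀ A, v + Λ * η - c * η ^ 2 ≤ J S A

/-- A bound for the error at a pair of normal distributions with budget excesses `t sx`, `t sw`. -/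
lemma mse_le_of_excess {H : Matrix (Fin m) (Fin n) ℝ} {f : Vec m → Vec n} (hf : Measurable f)
    {v : ℝ} (hv : 0 ≤ v) {μx : Vec n} {S₀x Sx : Matrix (Fin n) (Fin n) ℝ} {μw : Vec m}
    {S₀w Sw : Matrix (Fin m) (Fin m) ℝ} {rx rw : ℝ}
    (hball : ∀ Px Pw, Near (multivariateGaussian μx S₀x) rx Px →
      Near (multivariateGaussian μw S₀w) rw Pw → mse H f (Px.prod Pw) ≤ ENNReal.ofReal v)
    {Λx cx hx Λw cw hw : ℝ}
    (hpx : HasPath S₀x rx v Λx cx hx fun S (A : Matrix (Fin n) (Fin m) ℝ) =>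
      quad (A * H - 1) S + quad A Sw)
    (hpw : HasPath S₀w rw v Λw cw hw fun S (A : Matrix (Fin n) (Fin m) ℝ) =>
      quad A S + quad (A * H - 1) Sx)
    {t : ℝ} (ht : 0 ≤ t) (ht1 : t ≤ 1) {η : ℝ} (hη : 0 < η) (hηx : η ≤ hx) (hηw : η ≤ hw)
    {Tx Ux : Matrix (Fin n) (Fin n) ℝ} {Tw Uw : Matrix (Fin m) (Fin m) ℝ}
    (hTx : Tx.PosSemidef) (hTw : Tw.PosSemidef)
    {δx : Vec n} {δw : Vec m} {sx sw : ℝ}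
    (hx' : Feas S₀x (rx + t * sx) δx (t • Tx + (1 - t) • Sx) Ux)
    (hw' : Feas S₀w (rw + t * sw) δw (t • Tw + (1 - t) • Sw) Uw) :
    0 ≤ v + t * (1 - t) * (Λx * sx + Λw * sw) + t ^ 2 * v / η * (|sx| + |sw|)
        + t ^ 2 * v / η ^ 2 * (|sx| * |sw|) + (1 - t) * t * η * (cx * |sx| + cw * |sw|) ∧
    mse H f ((multivariateGaussian (μx + δx) (t • Tx + (1 - t) • Sx)).prod
        (multivariateGaussian (μw + δw) (t • Tw + (1 - t) • Sw)))
      ≤ ENNReal.ofReal (v + t * (1 - t) * (Λx * sx + Λw * sw) + t ^ 2 * v / η * (|sx| + |sw|)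
        + t ^ 2 * v / η ^ 2 * (|sx| * |sw|) + (1 - t) * t * η * (cx * |sx| + cw * |sw|)) := by
  -- The compensating budget is moved by exactly `η`, against the sign of the excess; the size of
  -- the excess enters only through the mixing weight.
  have hsgn : ∀ s : ℝ, ∃ θ : ℝ, |θ| = η ∧ |s| * θ = - η * s := by
    intro s
    rcases le_total 0 s with h | h
    · exact ⟨-η, by rw [abs_neg, abs_of_pos hη], by rw [abs_of_nonneg h]; ring⟩
    · exact ⟨η, abs_of_pos hη, by rw [abs_of_nonpos h]; ring⟩
  obtain ⟨θx, hθx, ex⟩ := hsgn sx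
  obtain ⟨θw, hθw, ew⟩ := hsgn sw
  obtain ⟨Vx, Dx, hFx, hJx⟩ := hpx θx (by rw [hθx]; exact hηx)
  obtain ⟨Vw, Dw, hFw, hJw⟩ := hpw θw (by rw [hθw]; exact hηw)
  have hθx2 : θx ^ 2 = η ^ 2 := by rw [← sq_abs, hθx]
  have hθw2 : θw ^ 2 = η ^ 2 := by rw [← sq_abs, hθw]
  rw [hθx2] at hJx
  rw [hθw2] at hJw
  have nPx := hx'.near μx
  have nPw := hw'.near μw
  have nTx := hFx.near μx
  have nTw := hFw.near μw
  rw [add_zero] at nTx nTw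
  have ht1' : 0 ≤ 1 - t := by linarith
  -- Discarding the `t` parts costs a factor `1 - t`. This is harmless: the bound is used with a
  -- weight `t |sx| / η`, so the loss is of order `t²`.
  have lx : ENNReal.ofReal ((1 - t) * (v + Λx * θx - cx * η ^ 2))
      ≤ mse H f ((multivariateGaussian μx Vx).prod
        (multivariateGaussian (μw + δw) (t • Tw + (1 - t) • Sw))) := by
    obtain ⟨A, hA⟩ := exists_le_mse H hf μx hFx.posSemidef (μw + δw) hw'.posSemidef
    refine le_trans (ENNReal.ofReal_le_ofReal ?_) hA
    have h1 := mul_le_mul_of_nonneg_left (hJx A) ht1'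
    have h2 := mul_nonneg ht (quad_nonneg A hTw)
    have h3 := mul_nonneg ht (quad_nonneg (A * H - 1) hFx.posSemidef)
    rw [quad_add, quad_smul, quad_smul]
    simp only [mul_add] at h1
    linarith
  have lw : ENNReal.ofReal ((1 - t) * (v + Λw * θw - cw * η ^ 2))
      ≤ mse H f ((multivariateGaussian (μx + δx) (t • Tx + (1 - t) • Sx)).prod
        (multivariateGaussian μw Vw)) := by
    obtain ⟨A, hA⟩ := exists_le_mse H hf (μx + δx) hx'.posSemidef μw hFw.posSemidef
    refine le_trans (ENNReal.ofReal_le_ofReal ?_) hA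
    have h1 := mul_le_mul_of_nonneg_left (hJw A) ht1'
    have h2 := mul_nonneg ht (quad_nonneg (A * H - 1) hTx)
    have h3 := mul_nonneg ht (quad_nonneg A hFw.posSemidef)
    rw [quad_add, quad_smul, quad_smul]
    simp only [mul_add] at h1
    linarith
  have hcomp := mse_le_of_compensate hv hball nPx nTx nPw nTw hx'.nonneg hFx.nonneg hw'.nonneg
    -- With these weights the budget change `ox θx = -t sx` cancels the excess exactly, and likewise
    -- for `w`.
    hFw.nonneg (ox := t * |sx| / η) (ow := t * |sw| / η) (by positivity) (by positivity)
    (by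
      have : t * |sx| / η * (rx + θx) = t * |sx| / η * rx + t / η * (|sx| * θx) := by ring
      rw [this, ex]
      field_simp
      ring)
    (by
      have : t * |sw| / η * (rw + θw) = t * |sw| / η * rw + t / η * (|sw| * θw) := by ring
      rw [this, ew]
      field_simp
      ring) lx lw
  have e : v * ((1 + t * |sx| / η) * (1 + t * |sw| / η))
      - t * |sx| / η * ((1 - t) * (v + Λx * θx - cx * η ^ 2))
      - t * |sw| / η * ((1 - t) * (v + Λw * θw - cw * η ^ 2))
      = v + t * (1 - t) * (Λx * sx + Λw * sw) + t ^ 2 * v / η * (|sx| + |sw|)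
        + t ^ 2 * v / η ^ 2 * (|sx| * |sw|) + (1 - t) * t * η * (cx * |sx| + cw * |sw|) := by
    have e1 : t * |sx| / η * ((1 - t) * (v + Λx * θx - cx * η ^ 2))
        = (1 - t) * t / η * (|sx| * v + Λx * (|sx| * θx) - cx * |sx| * η ^ 2) := by ring
    have e2 : t * |sw| / η * ((1 - t) * (v + Λw * θw - cw * η ^ 2))
        = (1 - t) * t / η * (|sw| * v + Λw * (|sw| * θw) - cw * |sw| * η ^ 2) := by ring
    rw [e1, e2, ex, ew]
    field_simp
    ring
  rw [e] at hcomp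
  exact hcomp

end

/-! ### Gaussian random shifts and finite mixtures of moments -/

section

variable {d n m N : ℕ}

lemma quad_one (K : Matrix (Fin n) (Fin N) ℝ) : quad K 1 = ∑ i, ∑ j, K i j ^ 2 := by
  simp [quad, Matrix.trace, mul_apply, pow_two]

lemma quad_smul_left (K : Matrix (Fin n) (Fin d) ℝ) (c : ℝ) (S : Matrix (Fin d) (Fin d) ℝ) :
    quad (c • K) S = c ^ 2 * quad K S := by
  simp [quad]
  ring

/-- Gaussian fourth moments are finite. Square integrability is needed for the product `|sx| * |sw|`
of two excesses. -/
lemma memLp_norm_sq_toEuclideanLin (D : Matrix (Fin n) (Fin N) ℝ) (P : Measure (Vec N))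
    [IsGaussian P] : MemLp (fun g => ‖D.toEuclideanLin g‖ ^ 2) 2 P := by
  have h := (LinearMap.toContinuousLinearMap D.toEuclideanLin).comp_memLp'
    (IsGaussian.memLp_id P 4 (by simp))
  have h2 := h.norm_rpow_div 2
  have e : (4 : ℝ≥0∞) / 2 = 2 := by
    rw [eq_comm, ENNReal.eq_div_iff (by simp) (by simp)]
    norm_num
  rw [e] at h2
  simpa using h2

lemma integral_norm_sq_toEuclideanLin (D : Matrix (Fin n) (Fin N) ℝ) :
    ∫ g, ‖D.toEuclideanLin g‖ ^ 2 ∂(multivariateGaussian (0 : Vec N) 1) = quad D 1 := by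
  have h := lintegral_enorm_sq_affine (P2_of_isGaussian (multivariateGaussian (0 : Vec N) 1)) D 0
  rw [covMat_multivariateGaussian _ PosSemidef.one, meanVec_multivariateGaussian] at h
  simp only [add_zero, map_zero, norm_zero, enorm_sq_eq] at h
  rw [integral_eq_lintegral_of_nonneg_ae (Filter.Eventually.of_forall fun _ => by positivity)
    (by fun_prop), h]
  simpa using quad_nonneg D PosSemidef.one

/-- The matrix with columns `√pᵢ dᵢ`. -/
def spread (p : Fin N → ℝ) (δ : Fin N → Vec d) : Matrix (Fin d) (Fin N) ℝ :=
  Matrix.of fun a i => √(p i) * δ i a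

lemma mul_spread (K : Matrix (Fin n) (Fin d) ℝ) (p : Fin N → ℝ) (δ : Fin N → Vec d) :
    K * spread p δ = spread p fun i => K.toEuclideanLin (δ i) := by
  ext a i
  simp only [spread, mul_apply, of_apply, toEuclideanLin_coord, Finset.mul_sum]
  exact Finset.sum_congr rfl fun j _ => by ring

lemma spread_add (p : Fin N → ℝ) (δ δ' : Fin N → Vec d) :
    spread p δ + spread p δ' = spread p fun i => δ i + δ' i := by
  ext a i
  simp [spread, mul_add]

lemma quad_spread {p : Fin N → ℝ} (hp : ∀ i, 0 ≤ p i) (δ : Fin N → Vec d) :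
    quad (spread p δ) 1 = ∑ i, p i * ‖δ i‖ ^ 2 := by
  rw [quad_one, Finset.sum_comm]
  refine Finset.sum_congr rfl fun i _ => ?_
  rw [norm_sq_eq_sum, Finset.mul_sum]
  refine Finset.sum_congr rfl fun a _ => ?_
  simp [spread, mul_pow, Real.sq_sqrt (hp i)]

/-- Along the random shift `√t ∑ √pᵢ gᵢ δᵢ`, a mixture of feasible points has cost at most
`r + t (‖∑ √pᵢ gᵢ δᵢ‖² - ∑ pᵢ ‖δᵢ‖²)`. -/
lemma Feas.mixture {S₀ S C : Matrix (Fin d) (Fin d) ℝ} {r : ℝ} (h : Feas S₀ r 0 S C)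
    {p : Fin N → ℝ} (hp : ∀ i, 0 ≤ p i) (hp1 : ∑ i, p i = 1) {δ : Fin N → Vec d}
    {T U : Fin N → Matrix (Fin d) (Fin d) ℝ} (hT : ∀ i, Feas S₀ r (δ i) (T i) (U i))
    {t : ℝ} (h0 : 0 ≤ t) (h1 : t ≤ 1) (g : Vec N) :
    Feas S₀ (r + t * (‖(spread p δ).toEuclideanLin g‖ ^ 2 - quad (spread p δ) 1))
      ((√t • spread p δ).toEuclideanLin g) (t • (∑ i, p i • T i) + (1 - t) • S)
      (t • (∑ i, p i • U i) + (1 - t) • C) := by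
  have hs := feas_sum Finset.univ (fun i => (hT i).centered) hp hp1
  refine (hs.combine h h0 h1 _).mono (le_of_eq ?_)
  rw [quad_spread hp]
  simp only [map_smul, LinearMap.smul_apply, norm_smul, mul_pow, Real.norm_eq_abs, sq_abs,
    Real.sq_sqrt h0, mul_sub, Finset.sum_sub_distrib, ← Finset.sum_mul, hp1]
  ring

section Mixture

variable {H : Matrix (Fin m) (Fin n) ℝ} {f : Vec m → Vec n} {v : ℝ} {μx : Vec n}
  {S₀x Sx Cx : Matrix (Fin n) (Fin n) ℝ} {μw : Vec m} {S₀w Sw Cw : Matrix (Fin m) (Fin m) ℝ}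
  {rx rw Λx cx hx Λw cw hw : ℝ}

lemma exists_mixture_le_of_params (hf : Measurable f) (hv : 0 ≤ v)
    (hball : ∀ Px Pw, Near (multivariateGaussian μx S₀x) rx Px →
      Near (multivariateGaussian μw S₀w) rw Pw → mse H f (Px.prod Pw) ≤ ENNReal.ofReal v)
    (hSx : Feas S₀x rx 0 Sx Cx) (hSw : Feas S₀w rw 0 Sw Cw)
    (hmin : ∀ A : Matrix (Fin n) (Fin m) ℝ, v ≤ quad (A * H - 1) Sx + quad A Sw)
    (hpx : HasPath S₀x rx v Λx cx hx fun S (A : Matrix (Fin n) (Fin m) ℝ) =>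
      quad (A * H - 1) S + quad A Sw)
    (hpw : HasPath S₀w rw v Λw cw hw fun S (A : Matrix (Fin n) (Fin m) ℝ) =>
      quad A S + quad (A * H - 1) Sx) (hcx : 0 ≤ cx) (hcw : 0 ≤ cw)
    {p : Fin N → ℝ} (hp : ∀ i, 0 ≤ p i) (hp1 : ∑ i, p i = 1) {δx : Fin N → Vec n}
    {Tx Ux : Fin N → Matrix (Fin n) (Fin n) ℝ} (hTx : ∀ i, Feas S₀x rx (δx i) (Tx i) (Ux i))
    {δw : Fin N → Vec m} {Tw Uw : Fin N → Matrix (Fin m) (Fin m) ℝ}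
    (hTw : ∀ i, Feas S₀w rw (δw i) (Tw i) (Uw i)) :
    ∃ B₁ B₂ B₃ : ℝ, 0 ≤ B₁ ∧ 0 ≤ B₂ ∧ 0 ≤ B₃ ∧ ∀ t η : ℝ, 0 < t → t ≤ 1 → 0 < η → η ≤ hx → η ≤ hw →
      ∃ A : Matrix (Fin n) (Fin m) ℝ, ∑ i, p i * (quad (A * H - 1) (Tx i) + quad A (Tw i)
        + ‖(A * H - 1).toEuclideanLin (δx i) + A.toEuclideanLin (δw i)‖ ^ 2)
        ≤ v + t * (B₁ / η + B₂ / η ^ 2) + η * B₃ := by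
  set γ := multivariateGaussian (0 : Vec N) 1 with hγ
  set sx : Vec N → ℝ := fun g =>
    ‖(spread p δx).toEuclideanLin g‖ ^ 2 - quad (spread p δx) 1 with hsx
  set sw : Vec N → ℝ := fun g =>
    ‖(spread p δw).toEuclideanLin g‖ ^ 2 - quad (spread p δw) 1 with hsw
  have mx : MemLp sx 2 γ := (memLp_norm_sq_toEuclideanLin _ γ).sub (memLp_const _)
  have mw : MemLp sw 2 γ := (memLp_norm_sq_toEuclideanLin _ γ).sub (memLp_const _)
  have ix : Integrable sx γ := mx.integrable (by norm_num)
  have iw : Integrable sw γ := mw.integrable (by norm_num)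
  have ixw : Integrable (fun g => |sx g| * |sw g|) γ := mx.abs.integrable_mul mw.abs
  -- The mean excess vanishes, which removes the first-order term whatever the slope `Λx`.
  have zx : ∫ g, sx g ∂γ = 0 := by
    rw [hsx, integral_sub ((memLp_norm_sq_toEuclideanLin _ γ).integrable (by norm_num))
      (integrable_const _), integral_norm_sq_toEuclideanLin]
    simp
  have zw : ∫ g, sw g ∂γ = 0 := by
    rw [hsw, integral_sub ((memLp_norm_sq_toEuclideanLin _ γ).integrable (by norm_num))
      (integrable_const _), integral_norm_sq_toEuclideanLin]
    simp
  set Bx := ∫ g, |sx g| ∂γ with hBx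
  set Bw := ∫ g, |sw g| ∂γ with hBw
  set Bxw := ∫ g, |sx g| * |sw g| ∂γ with hBxw
  have hBx0 : 0 ≤ Bx := integral_nonneg fun g => abs_nonneg _
  have hBw0 : 0 ≤ Bw := integral_nonneg fun g => abs_nonneg _
  have hBxw0 : 0 ≤ Bxw := integral_nonneg fun g => by positivity
  refine ⟨v * (Bx + Bw), v * Bxw, cx * Bx + cw * Bw, by positivity, by positivity, by positivity,
    fun t η ht ht1 hη hηx hηw => ?_⟩
  have hTx0 : (∑ i, p i • Tx i).PosSemidef :=
    posSemidef_sum _ fun i _ => (hTx i).posSemidef.smul (hp i)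
  have hTw0 : (∑ i, p i • Tw i).PosSemidef :=
    posSemidef_sum _ fun i _ => (hTw i).posSemidef.smul (hp i)
  have hFx := hSx.mixture hp hp1 hTx ht.le ht1
  have hFw := hSw.mixture hp hp1 hTw ht.le ht1
  have hub := fun g => mse_le_of_excess hf hv hball hpx hpw ht.le ht1 hη hηx hηw hTx0 hTw0
    (hFx g) (hFw g)
  obtain ⟨A, hA⟩ := exists_le_lintegral_mse H hf μx (hFx 0).posSemidef μw (hFw 0).posSemidef
    (√t • spread p δx) (√t • spread p δw)
  refine ⟨A, ?_⟩
  set F : Vec N → ℝ := fun g => v + t * (1 - t) * (Λx * sx g + Λw * sw g)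
    + t ^ 2 * v / η * (|sx g| + |sw g|) + t ^ 2 * v / η ^ 2 * (|sx g| * |sw g|)
    + (1 - t) * t * η * (cx * |sx g| + cw * |sw g|) with hF
  have i1 : Integrable (fun g => t * (1 - t) * (Λx * sx g + Λw * sw g)) γ :=
    ((ix.const_mul _).add (iw.const_mul _)).const_mul _
  have i2 : Integrable (fun g => t ^ 2 * v / η * (|sx g| + |sw g|)) γ :=
    (ix.abs.add iw.abs).const_mul _
  have i3 : Integrable (fun g => t ^ 2 * v / η ^ 2 * (|sx g| * |sw g|)) γ := ixw.const_mul _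
  have i4 : Integrable (fun g => (1 - t) * t * η * (cx * |sx g| + cw * |sw g|)) γ :=
    ((ix.abs.const_mul _).add (iw.abs.const_mul _)).const_mul _
  have i0 : Integrable (fun _ => v) γ := integrable_const _
  have hFint : Integrable F γ := (((i0.add i1).add i2).add i3).add i4
  have hFval : ∫ g, F g ∂γ = v + t ^ 2 * v / η * (Bx + Bw) + t ^ 2 * v / η ^ 2 * Bxw
      + (1 - t) * t * η * (cx * Bx + cw * Bw) := by
    have eF : F = ((((fun _ => v) + fun g => t * (1 - t) * (Λx * sx g + Λw * sw g))
      + fun g => t ^ 2 * v / η * (|sx g| + |sw g|))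
      + fun g => t ^ 2 * v / η ^ 2 * (|sx g| * |sw g|))
      + fun g => (1 - t) * t * η * (cx * |sx g| + cw * |sw g|) := rfl
    rw [eF, integral_add' (((i0.add i1).add i2).add i3) i4, integral_add' ((i0.add i1).add i2) i3,
      integral_add' (i0.add i1) i2, integral_add' i0 i1, integral_const_mul, integral_const_mul,
      integral_const_mul, integral_const_mul, integral_add (ix.const_mul _) (iw.const_mul _),
      integral_add ix.abs iw.abs, integral_add (ix.abs.const_mul _) (iw.abs.const_mul _),
      integral_const_mul, integral_const_mul, integral_const_mul, integral_const_mul, zx, zw]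
    simp [← hBx, ← hBw, ← hBxw]
  have hle := hA.trans (lintegral_mono fun g => (hub g).2)
  rw [← ofReal_integral_eq_lintegral_ofReal hFint
    (Filter.Eventually.of_forall fun g => (hub g).1), hFval] at hle
  have hnn : 0 ≤ v + t ^ 2 * v / η * (Bx + Bw) + t ^ 2 * v / η ^ 2 * Bxw
      + (1 - t) * t * η * (cx * Bx + cw * Bw) := by
    rw [← hFval]
    exact integral_nonneg fun g => (hub g).1
  rw [ENNReal.ofReal_le_ofReal_iff hnn, quad_add, quad_add, quad_smul, quad_smul, quad_smul,
    quad_smul, quad_sum, quad_sum, Matrix.mul_smul, Matrix.mul_smul, ← smul_add, mul_spread,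
    mul_spread, spread_add, quad_smul_left, quad_spread hp, Real.sq_sqrt ht.le] at hle
  simp only [quad_smul] at hle
  -- The `Sx`, `Sw` part of the lower bound is worth at least `(1 - t) v`. What remains of both
  -- sides carries a factor `t`, which is then cancelled.
  have hm := mul_le_mul_of_nonneg_left (hmin A) (sub_nonneg.2 ht1)
  simp only [mul_add, Finset.sum_add_distrib] at hle hm ⊢
  refine le_of_mul_le_mul_left ?_ ht
  have h5 : t * (t * η * (cx * Bx + cw * Bw)) ≥ 0 := by positivity
  have e : t * (v + (t * ((v * Bx + v * Bw) / η) + t * (v * Bxw / η ^ 2))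
      + (η * (cx * Bx) + η * (cw * Bw)))
      = t * v + t ^ 2 * v / η * (Bx + Bw) + t ^ 2 * v / η ^ 2 * Bxw
        + t * η * (cx * Bx + cw * Bw) := by ring
  linarith

/-- `η` is fixed first, to make `η B₃` small; `t` is chosen afterwards, since its coefficient blows
up as `η → 0`. -/
lemma exists_mixture_le (hf : Measurable f) (hv : 0 ≤ v)
    (hball : ∀ Px Pw, Near (multivariateGaussian μx S₀x) rx Px →
      Near (multivariateGaussian μw S₀w) rw Pw → mse H f (Px.prod Pw) ≤ ENNReal.ofReal v)
    (hSx : Feas S₀x rx 0 Sx Cx) (hSw : Feas S₀w rw 0 Sw Cw)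
    (hmin : ∀ A : Matrix (Fin n) (Fin m) ℝ, v ≤ quad (A * H - 1) Sx + quad A Sw)
    (hpx : HasPath S₀x rx v Λx cx hx fun S (A : Matrix (Fin n) (Fin m) ℝ) =>
      quad (A * H - 1) S + quad A Sw)
    (hpw : HasPath S₀w rw v Λw cw hw fun S (A : Matrix (Fin n) (Fin m) ℝ) =>
      quad A S + quad (A * H - 1) Sx) (hcx : 0 ≤ cx) (hcw : 0 ≤ cw) (hx0 : 0 < hx) (hw0 : 0 < hw)
    {p : Fin N → ℝ} (hp : ∀ i, 0 ≤ p i) (hp1 : ∑ i, p i = 1) {δx : Fin N → Vec n}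
    {Tx Ux : Fin N → Matrix (Fin n) (Fin n) ℝ} (hTx : ∀ i, Feas S₀x rx (δx i) (Tx i) (Ux i))
    {δw : Fin N → Vec m} {Tw Uw : Fin N → Matrix (Fin m) (Fin m) ℝ}
    (hTw : ∀ i, Feas S₀w rw (δw i) (Tw i) (Uw i)) {ε : ℝ} (hε : 0 < ε) :
    ∃ A : Matrix (Fin n) (Fin m) ℝ, ∑ i, p i * (quad (A * H - 1) (Tx i) + quad A (Tw i)
        + ‖(A * H - 1).toEuclideanLin (δx i) + A.toEuclideanLin (δw i)‖ ^ 2) ≤ v + ε := by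
  obtain ⟨B₁, B₂, B₃, h1, h2, h3, h⟩ := exists_mixture_le_of_params hf hv hball hSx hSw hmin hpx
    hpw hcx hcw hp hp1 hTx hTw
  obtain ⟨η, hη, hηh, hηε⟩ : ∃ η : ℝ, 0 < η ∧ (η ≤ hx ∧ η ≤ hw) ∧ η * B₃ ≤ ε / 2 := by
    refine ⟨min (min hx hw) (ε / (2 * (B₃ + 1))), by positivity,
      ⟨(min_le_left _ _).trans (min_le_left _ _), (min_le_left _ _).trans (min_le_right _ _)⟩, ?_⟩
    calc _ ≤ ε / (2 * (B₃ + 1)) * (B₃ + 1) :=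
          mul_le_mul (min_le_right _ _) (by linarith) h3 (by positivity)
      _ = ε / 2 := by field_simp
  obtain ⟨B, hB⟩ : ∃ B, B = B₁ / η + B₂ / η ^ 2 := ⟨_, rfl⟩
  have hB0 : 0 ≤ B := by rw [hB]; positivity
  obtain ⟨A, hA⟩ := h (min 1 (ε / (2 * (B + 1)))) η (by positivity) (min_le_left _ _) hη hηh.1 hηh.2
  refine ⟨A, hA.trans ?_⟩
  rw [← hB]
  have : min 1 (ε / (2 * (B + 1))) * B ≤ ε / 2 :=
    calc _ ≤ ε / (2 * (B + 1)) * (B + 1) :=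
          mul_le_mul (min_le_right _ _) (by linarith) hB0 (by positivity)
      _ = ε / 2 := by field_simp
  linarith

end Mixture

end

/-! ### From finite mixtures to a common bound by minimax and compactness -/

section

section Minimax

variable {V ι : Type*} [AddCommGroup V] [Module ℝ V] [TopologicalSpace V] [IsTopologicalAddGroup V]
  [ContinuousSMul ℝ V] {Ψ : ι → V → ℝ} {v : ℝ}

/-- Sion's theorem on the simplex of weights, with the sign reversed so that the compact variable is
the minimising one. Compactness reduces the choice of `A` to finitely many candidates, and
evaluation at the vertices of the simplex recovers the individual `Ψ (i k)`. -/
lemma exists_forall_le_of_mixtures (hc : ∀ i, Continuous (Ψ i))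
    (hconv : ∀ i, ConvexOn ℝ Set.univ (Ψ i)) {N : ℕ} [NeZero N] (i : Fin N → ι)
    (h : ∀ p : Fin N → ℝ, (∀ k, 0 ≤ p k) → ∑ k, p k = 1 → ∀ ε > 0, ∃ A,
      ∑ k, p k * Ψ (i k) A ≤ v + ε) {ε : ℝ} (hε : 0 < ε) :
    ∃ A, ∀ k, Ψ (i k) A ≤ v + ε := by
  set f : (Fin N → ℝ) → V → ℝ := fun p A => -∑ k, p k * Ψ (i k) A with hf
  have hfp : ∀ A, Continuous fun p => f p A := fun A => by
    simp only [hf]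
    fun_prop
  have hfA : ∀ p, Continuous (f p) := fun p =>
    (continuous_finsetSum _ fun k _ => (hc (i k)).const_mul _).neg
  have hK : IsCompact (stdSimplex ℝ (Fin N)) := isCompact_stdSimplex ℝ (Fin N)
  have hex : ∀ p ∈ stdSimplex ℝ (Fin N), ∃ A, -(v + ε) < f p A := by
    intro p hp
    obtain ⟨A, hA⟩ := h p hp.1 hp.2 (ε / 2) (by positivity)
    exact ⟨A, by simp only [hf]; linarith⟩
  obtain ⟨s, hs⟩ := hK.elim_finite_subcover (fun A => {p | -(v + ε) < f p A})
    (fun A => isOpen_lt continuous_const (hfp A))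
    (fun p hp => by
      obtain ⟨A, hA⟩ := hex p hp
      exact Set.mem_iUnion.2 ⟨A, hA⟩)
  obtain ⟨A, -, hA⟩ := Sion.exists_lt_iInf_of_lt_iInf_of_finite (X := stdSimplex ℝ (Fin N))
    (Y := (Set.univ : Set V)) (f := f) ⟨_, single_mem_stdSimplex ℝ (0 : Fin N)⟩ hK
    (fun A _ => (hfp A).lowerSemicontinuous.lowerSemicontinuousOn _)
    (fun A _ => by
      refine ConvexOn.quasiconvexOn ⟨convex_stdSimplex ℝ (Fin N), fun p _ q _ a b _ _ _ => ?_⟩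
      simp only [hf, Pi.add_apply, Pi.smul_apply, smul_eq_mul, add_mul, Finset.sum_add_distrib,
        mul_assoc, ← Finset.mul_sum]
      linarith)
    convex_univ
    (fun p _ => (hfA p).upperSemicontinuous.upperSemicontinuousOn _)
    (fun p hp => by
      refine ConcaveOn.quasiconcaveOn ?_
      have : ConvexOn ℝ Set.univ fun A => ∑ k, p k * Ψ (i k) A := by
        refine ⟨convex_univ, fun A _ B _ a b ha hb hab => ?_⟩
        simp only [smul_eq_mul, Finset.mul_sum, ← Finset.sum_add_distrib]
        refine Finset.sum_le_sum fun k _ => ?_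
        have := mul_le_mul_of_nonneg_left
          ((hconv (i k)).2 (Set.mem_univ A) (Set.mem_univ B) ha hb hab) (hp.1 k)
        simp only [smul_eq_mul] at this
        linarith
      exact this.neg)
    (convex_stdSimplex ℝ (Fin N)) s.finite_toSet (Set.subset_univ _) (t := -(v + ε))
    (fun p hp => by
      obtain ⟨A, hA, hp'⟩ := Set.mem_iUnion₂.1 (hs hp)
      exact ⟨A, hA, hp'⟩)
  refine ⟨A, fun k => ?_⟩
  have := hA _ (single_mem_stdSimplex ℝ k)
  simp only [hf, Pi.single_apply, ite_mul, one_mul, zero_mul, Finset.sum_ite_eq',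
    Finset.mem_univ, if_true] at this
  linarith

/-- Finite intersection property. The index `i₀` is added to every finite family, with tolerance at
most `1`, so that the common points stay in the compact set. -/
lemma exists_forall_le_of_compact_sublevel (hc : ∀ i, Continuous (Ψ i))
    (hconv : ∀ i, ConvexOn ℝ Set.univ (Ψ i))
    (h : ∀ (N : ℕ) (i : Fin N → ι) (p : Fin N → ℝ), (∀ k, 0 ≤ p k) → ∑ k, p k = 1 →
      ∀ ε > 0, ∃ A, ∑ k, p k * Ψ (i k) A ≤ v + ε)
    (i₀ : ι) (hK : IsCompact {A | Ψ i₀ A ≤ v + 1}) : ∃ A, ∀ i, Ψ i A ≤ v := by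
  obtain ⟨A, -, hA⟩ := hK.inter_iInter_nonempty
    (fun q : ι × {ε : ℝ // 0 < ε} => {A | Ψ q.1 A ≤ v + q.2})
    (fun q => isClosed_le (hc _) continuous_const) (fun u => by
      classical
      obtain ⟨ε, hε, hε1, hεu⟩ : ∃ ε : ℝ, 0 < ε ∧ ε ≤ 1 ∧ ∀ q ∈ u, ε ≤ q.2 := by
        induction u using Finset.induction_on with
        | empty => exact ⟨1, one_pos, le_rfl, by simp⟩
        | insert q u _ ih =>
          obtain ⟨ε, h0, h1, h2⟩ := ih
          refine ⟨min ε q.2, lt_min h0 q.2.2, (min_le_left _ _).trans h1, fun r hr => ?_⟩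
          rcases Finset.mem_insert.1 hr with rfl | hr
          · exact min_le_right _ _
          · exact (min_le_left _ _).trans (h2 r hr)
      set w := insert i₀ (u.image Prod.fst) with hw
      have : NeZero w.card := ⟨(Finset.card_pos.2 ⟨i₀, Finset.mem_insert_self _ _⟩).ne'⟩
      obtain ⟨A, hA⟩ := exists_forall_le_of_mixtures hc hconv (fun k => (w.equivFin.symm k : ι))
        (h _ _) hε
      have hA' : ∀ i ∈ w, Ψ i A ≤ v + ε := fun i hi => by
        simpa using hA (w.equivFin ⟨i, hi⟩)
      refine ⟨A, ?_, ?_⟩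
      · have := hA' i₀ (Finset.mem_insert_self _ _)
        show Ψ i₀ A ≤ v + 1
        linarith
      · refine Set.mem_iInter₂.2 fun q hq => ?_
        have := hA' q.1 (Finset.mem_insert_of_mem (Finset.mem_image_of_mem _ hq))
        show Ψ q.1 A ≤ v + q.2
        linarith [hεu q hq])
  refine ⟨A, fun i => le_of_forall_pos_le_add fun ε hε => ?_⟩
  exact Set.mem_iInter.1 hA (i, ⟨ε, hε⟩)

end Minimax

end

/-! ### An affine estimator with error at most the saddle value for all feasible moments -/

section

variable {d n m : ℕ}

lemma IsNonnegQuadratic.convexOn {V : Type*} [AddCommGroup V] [Module ℝ V] {q : V → ℝ}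
    (hq : IsNonnegQuadratic q) : ConvexOn ℝ Set.univ q := by
  refine ⟨convex_univ, fun A _ B _ a b ha hb hab => ?_⟩
  obtain ⟨l, c, hc, h⟩ := hq.2 A (B - A)
  have h1 := h 1
  have h2 := h b
  rw [one_smul, add_sub_cancel] at h1
  have e : a • A + b • B = A + b • (B - A) := by
    rw [eq_sub_of_add_eq hab, sub_smul, one_smul, smul_sub]
    abel
  rw [e, h2, smul_eq_mul, smul_eq_mul, h1]
  have hb1 : b ^ 2 * c ≤ b * c := by
    have : b ≤ 1 := by linarith
    rw [pow_two, mul_assoc]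
    exact mul_le_of_le_one_left (mul_nonneg hb hc) this
  have : a = 1 - b := by linarith
  subst this
  linarith

/-- The mean square error of `y ↦ A (y - H μx - μw) + μx` when the means are off by `δx`, `δw`. -/
def affineError (H : Matrix (Fin m) (Fin n) ℝ) (δx : Vec n) (Tx : Matrix (Fin n) (Fin n) ℝ)
    (δw : Vec m) (Tw : Matrix (Fin m) (Fin m) ℝ) (A : Matrix (Fin n) (Fin m) ℝ) : ℝ :=
  quad (A * H - 1) Tx + quad A Tw
    + ‖(A * H - 1).toEuclideanLin δx + A.toEuclideanLin δw‖ ^ 2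

lemma isNonnegQuadratic_bias (H : Matrix (Fin m) (Fin n) ℝ) (δx : Vec n) (δw : Vec m) :
    IsNonnegQuadratic fun A : Matrix (Fin n) (Fin m) ℝ =>
      ‖(A * H - 1).toEuclideanLin δx + A.toEuclideanLin δw‖ ^ 2 := by
  refine ⟨fun A => by positivity, fun A B => ?_⟩
  refine ⟨inner ℝ ((A * H - 1).toEuclideanLin δx + A.toEuclideanLin δw)
    ((B * H).toEuclideanLin δx + B.toEuclideanLin δw),
    ‖(B * H).toEuclideanLin δx + B.toEuclideanLin δw‖ ^ 2, by positivity, fun s => ?_⟩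
  have e : ((A + s • B) * H - 1).toEuclideanLin δx + (A + s • B).toEuclideanLin δw
      = ((A * H - 1).toEuclideanLin δx + A.toEuclideanLin δw)
        + s • ((B * H).toEuclideanLin δx + B.toEuclideanLin δw) := by
    have : (A + s • B) * H - 1 = (A * H - 1) + s • (B * H) := by
      rw [Matrix.add_mul, Matrix.smul_mul]
      abel
    rw [this]
    simp only [map_add, map_smul, LinearMap.add_apply, LinearMap.smul_apply, smul_add]
    abel
  simp only [e]
  rw [norm_add_sq_real, inner_smul_right, norm_smul, mul_pow, Real.norm_eq_abs, sq_abs]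
  ring

lemma convexOn_affineError (H : Matrix (Fin m) (Fin n) ℝ) (δx : Vec n)
    {Tx : Matrix (Fin n) (Fin n) ℝ} (δw : Vec m) {Tw : Matrix (Fin m) (Fin m) ℝ}
    (hTx : Tx.PosSemidef) (hTw : Tw.PosSemidef) :
    ConvexOn ℝ Set.univ (affineError H δx Tx δw Tw) :=
  ((quad_comp_isNonnegQuadratic H hTx).convexOn.add (quad_isNonnegQuadratic hTw).convexOn).add
    (isNonnegQuadratic_bias H δx δw).convexOn

lemma continuous_affineError (H : Matrix (Fin m) (Fin n) ℝ) (δx : Vec n)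
    (Tx : Matrix (Fin n) (Fin n) ℝ) (δw : Vec m) (Tw : Matrix (Fin m) (Fin m) ℝ) :
    Continuous (affineError H δx Tx δw Tw) := by
  have h1 : ∀ {k l : ℕ} (T : Matrix (Fin l) (Fin l) ℝ),
      Continuous fun K : Matrix (Fin k) (Fin l) ℝ => quad K T := fun T => by
    unfold quad
    fun_prop
  have h2 : Continuous fun A : Matrix (Fin n) (Fin m) ℝ => A * H - 1 := by fun_prop
  have h3 : ∀ {k l : ℕ} (x : Vec l),
      Continuous fun K : Matrix (Fin k) (Fin l) ℝ => K.toEuclideanLin x := fun x =>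
    LinearMap.continuous_of_finiteDimensional
      (LinearMap.applyₗ x ∘ₗ (toEuclideanLin (𝕜 := ℝ)).toLinearMap)
  exact (((h1 Tx).comp h2).add (h1 Tw)).add ((((h3 δx).comp h2).add (h3 δw)).norm.pow 2)

/-- Adding to the nominal variable an uncorrelated noise of covariance `κ • 1` costs its trace. -/
lemma feas_add_smul_one {S₀ : Matrix (Fin d) (Fin d) ℝ} (h : S₀.PosSemidef) {κ : ℝ} (hκ : 0 ≤ κ) :
    Feas S₀ (κ * d) 0 (S₀ + κ • 1) S₀ := by
  have h0 := feas_self h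
  constructor
  · have e : fromBlocks (S₀ + κ • 1) S₀ S₀ᵀ S₀ = fromBlocks S₀ S₀ S₀ᵀ S₀
        + fromBlocks (κ • (1 : Matrix (Fin d) (Fin d) ℝ)) 0 0ᵀ (0 : Matrix (Fin d) (Fin d) ℝ) := by
      simp [fromBlocks_add]
    rw [e]
    refine h0.1.add ?_
    have := ((PosSemidef.one (n := Fin d) (R := ℝ)).mul_mul_conjTranspose_same
      (fromRows (1 : Matrix (Fin d) (Fin d) ℝ) (0 : Matrix (Fin d) (Fin d) ℝ))).smul hκ
    convert this using 1
    ext i j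
    rcases i with i | i <;> rcases j with j | j <;>
      simp [fromRows_mul, conjTranspose_eq_transpose_of_trivial, one_apply, eq_comm]
  · have := h0.2
    simp [trace_add, trace_smul, trace_one] at this ⊢
    linarith

lemma isCompact_sublevel (H : Matrix (Fin m) (Fin n) ℝ) {Tx : Matrix (Fin n) (Fin n) ℝ}
    {S : Matrix (Fin m) (Fin m) ℝ} (hTx : Tx.PosSemidef) (hS : S.PosSemidef) {κ : ℝ} (hκ : 0 < κ)
    (b : ℝ) : IsCompact {A | affineError H 0 Tx 0 (S + κ • 1) A ≤ b} := by
  have hcl : IsClosed {A | affineError H 0 Tx 0 (S + κ • 1) A ≤ b} :=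
    isClosed_le (continuous_affineError _ _ _ _ _) continuous_const
  have hcpt : IsCompact (Set.univ.pi fun _ : Fin n => Set.univ.pi fun _ : Fin m =>
      Set.Icc (-√(b / κ)) (√(b / κ))) :=
    isCompact_univ_pi fun _ => isCompact_univ_pi fun _ => isCompact_Icc
  refine hcpt.of_isClosed_subset hcl fun (A : Matrix (Fin n) (Fin m) ℝ) hA i _ j _ => ?_
  have h1 : affineError H 0 Tx 0 (S + κ • 1) A ≤ b := hA
  have h2 := quad_nonneg (A * H - 1) hTx
  have h3 := quad_nonneg A hS
  simp only [affineError, map_zero, add_zero, norm_zero, quad_add, quad_smul, quad_one] at h1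
  have h4 : A i j ^ 2 ≤ ∑ i, ∑ j, A i j ^ 2 :=
    (Finset.single_le_sum (f := fun j => A i j ^ 2) (fun _ _ => sq_nonneg _)
      (Finset.mem_univ j)).trans (Finset.single_le_sum (f := fun i => ∑ j, A i j ^ 2)
      (fun _ _ => Finset.sum_nonneg fun _ _ => sq_nonneg _) (Finset.mem_univ i))
  have h5 : A i j ^ 2 ≤ b / κ := by
    rw [le_div_iff₀ hκ]
    have := mul_le_mul_of_nonneg_left h4 hκ.le
    have h6 : (0 : ℝ) ^ 2 = 0 := by norm_num
    linarith
  exact abs_le.1 (Real.abs_le_sqrt h5)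

variable {H : Matrix (Fin m) (Fin n) ℝ} {f : Vec m → Vec n} {v : ℝ} {μx : Vec n}
  {S₀x Sx Cx : Matrix (Fin n) (Fin n) ℝ} {μw : Vec m} {S₀w Sw Cw : Matrix (Fin m) (Fin m) ℝ}
  {rx rw Λx cx hx Λw cw hw : ℝ}

lemma exists_forall_affineError_le (hf : Measurable f) (hv : 0 ≤ v)
    (hball : ∀ Px Pw, Near (multivariateGaussian μx S₀x) rx Px →
      Near (multivariateGaussian μw S₀w) rw Pw → mse H f (Px.prod Pw) ≤ ENNReal.ofReal v)
    (hS₀x : S₀x.PosSemidef) (hS₀w : S₀w.PosSemidef) (hrx : 0 < rx) (hrw : 0 < rw)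
    (hSx : Feas S₀x rx 0 Sx Cx) (hSw : Feas S₀w rw 0 Sw Cw)
    (hmin : ∀ A : Matrix (Fin n) (Fin m) ℝ, v ≤ quad (A * H - 1) Sx + quad A Sw)
    {A₀ : Matrix (Fin n) (Fin m) ℝ} (hA₀ : quad (A₀ * H - 1) Sx + quad A₀ Sw ≤ v) :
    ∃ A, ∀ δx Tx Ux δw Tw Uw, Feas S₀x rx δx Tx Ux → Feas S₀w rw δw Tw Uw →
      affineError H δx Tx δw Tw A ≤ v := by
  have hSx0 := hSx.posSemidef
  have hSw0 := hSw.posSemidef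
  have hve : quad (A₀ * H - 1) Sx + quad A₀ Sw = v := le_antisymm hA₀ (hmin A₀)
  -- The covariances `Sx`, `Sw` are least favourable: `f` keeps the error at most `v` at every
  -- feasible pair, and some affine estimator does no worse than `f` there.
  have hval : ∀ S C S' C', Feas S₀x rx 0 S C → Feas S₀w rw 0 S' C' →
      ∃ A : Matrix (Fin n) (Fin m) ℝ, quad (A * H - 1) S + quad A S' ≤ v := by
    intro S C S' C' h h'
    obtain ⟨A, hA⟩ := exists_le_mse H hf μx h.posSemidef μw h'.posSemidef
    have h1 := h.near μx
    have h2 := h'.near μw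
    rw [add_zero] at h1 h2
    exact ⟨A, (ENNReal.ofReal_le_ofReal_iff hv).1 (hA.trans (hball _ _ h1 h2))⟩
  obtain ⟨Λx, cx, hx, -, hcx, hhx, hpx⟩ := exists_path (Φ := fun A => A * H - 1)
    (q₂ := fun A => quad A Sw) (A₀ := A₀) hrx hS₀x hSx (quad_comp_isNonnegQuadratic H hSx0)
    (quad_isNonnegQuadratic hSw0) (fun A => hve.trans_le (hmin A))
    (fun S' C' h => by rw [hve]; exact hval S' C' Sw Cw h hSw)
  obtain ⟨Λw, cw, hw, -, hcw, hhw, hpw⟩ := exists_path (Φ := fun A => A)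
    (q₂ := fun A => quad (A * H - 1) Sx) (A₀ := A₀) hrw hS₀w hSw (quad_isNonnegQuadratic hSw0)
    (quad_comp_isNonnegQuadratic H hSx0)
    (fun A => by rw [add_comm, hve, add_comm]; exact hmin A)
    (fun S' C' h => by
      obtain ⟨A, hA⟩ := hval Sx Cx S' C' hSx h
      exact ⟨A, by rw [add_comm, add_comm (quad A₀ Sw), hve]; exact hA⟩)
  have hpx' : HasPath S₀x rx v Λx cx hx fun S (A : Matrix (Fin n) (Fin m) ℝ) =>
      quad (A * H - 1) S + quad A Sw := by
    rw [hve] at hpx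
    exact hpx
  have hpw' : HasPath S₀w rw v Λw cw hw fun S (A : Matrix (Fin n) (Fin m) ℝ) =>
      quad A S + quad (A * H - 1) Sx := by
    rw [add_comm, hve] at hpw
    exact hpw
  let ι := {q : (Vec n × Matrix (Fin n) (Fin n) ℝ × Matrix (Fin n) (Fin n) ℝ) ×
    (Vec m × Matrix (Fin m) (Fin m) ℝ × Matrix (Fin m) (Fin m) ℝ) //
    Feas S₀x rx q.1.1 q.1.2.1 q.1.2.2 ∧ Feas S₀w rw q.2.1 q.2.2.1 q.2.2.2}
  -- This much noise added to `S₀w` fits the budget and makes the error coercive in `A`, which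
  -- supplies the compact sublevel set. The `+ 1` covers `m = 0`.
  have hκ : 0 < rw / (m + 1) := by positivity
  have hκm : rw / (m + 1) * m ≤ rw := by
    rw [div_mul_eq_mul_div, div_le_iff₀ (by positivity)]
    linarith
  obtain ⟨A, hA⟩ := exists_forall_le_of_compact_sublevel (v := v)
    (Ψ := fun q : ι => affineError H q.1.1.1 q.1.1.2.1 q.1.2.1 q.1.2.2.1)
    (fun q => continuous_affineError _ _ _ _ _)
    (fun q => convexOn_affineError H _ _ q.2.1.posSemidef q.2.2.posSemidef)
    (fun N i p hp hp1 ε hε => exists_mixture_le hf hv hball hSx hSw hmin hpx' hpw' hcx hcw hhx hhw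
      hp hp1 (fun k => (i k).2.1) (fun k => (i k).2.2) hε)
    ⟨⟨⟨0, S₀x, S₀x⟩, ⟨0, S₀w + (rw / (m + 1)) • 1, S₀w⟩⟩, (feas_self hS₀x).mono hrx.le,
      (feas_add_smul_one hS₀w hκ.le).mono hκm⟩
    (isCompact_sublevel H hS₀x hS₀w hκ _)
  exact ⟨A, fun δx Tx Ux δw Tw Uw h h' => hA ⟨⟨⟨δx, Tx, Ux⟩, ⟨δw, Tw, Uw⟩⟩, h, h'⟩⟩

end

/-! ### Transfer of saddle points between the two problems -/

section

variable {d n m : ℕ} {H : Matrix (Fin m) (Fin n) ℝ} {μx : Vec n} {Sx : Matrix (Fin n) (Fin n) ℝ}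
  {ρx : ℝ} {μw : Vec m} {Sw : Matrix (Fin m) (Fin m) ℝ} {ρw : ℝ}

lemma gaussianBall_subset_ball : gaussianBall μx Sx ρx μw Sw ρw ⊆ ball μx Sx ρx μw Sw ρw := by
  rintro P ⟨Px, Pw, h, hx, hw, hx', hw', -⟩
  exact ⟨Px, Pw, h, hx, hw, hx', hw'⟩

lemma mem_ball_of_near {Px : Measure (Vec n)} {Pw : Measure (Vec m)} (hρx : 0 ≤ ρx) (hρw : 0 ≤ ρw)
    (hx : Near (multivariateGaussian μx Sx) (ρx ^ 2) Px)
    (hw : Near (multivariateGaussian μw Sw) (ρw ^ 2) Pw) :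
    Px.prod Pw ∈ ball μx Sx ρx μw Sw ρw :=
  ⟨Px, Pw, rfl, hx.1, hw.1, hx.W2_le hρx, hw.W2_le hρw⟩

lemma mem_gaussianBall_of_feas {Tx Ux : Matrix (Fin n) (Fin n) ℝ} {Tw Uw : Matrix (Fin m) (Fin m) ℝ}
    {δx : Vec n} {δw : Vec m} (hρx : 0 ≤ ρx) (hρw : 0 ≤ ρw)
    (hx : Feas Sx (ρx ^ 2) δx Tx Ux) (hw : Feas Sw (ρw ^ 2) δw Tw Uw) :
    (multivariateGaussian (μx + δx) Tx).prod (multivariateGaussian (μw + δw) Tw)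
      ∈ gaussianBall μx Sx ρx μw Sw ρw :=
  ⟨_, _, rfl, (hx.near μx).1, (hw.near μw).1, (hx.near μx).W2_le hρx, (hw.near μw).W2_le hρw,
    ⟨_, _, hx.posSemidef, rfl⟩, ⟨_, _, hw.posSemidef, rfl⟩⟩

/-- Every distribution in the ball has a normal distribution with the same mean vectors and
covariance matrices in the ball, with the same error for linear estimators. -/
lemma exists_gaussianBall_mse_eq (hSx : Sx.PosSemidef) (hSw : Sw.PosSemidef) (hρx : 0 ≤ ρx)
    (hρw : 0 ≤ ρw) {f : Vec m → Vec n} (hf : f ∈ linearEstimators n m)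
    {Q : Measure (Vec n × Vec m)} (hQ : Q ∈ ball μx Sx ρx μw Sw ρw) :
    ∃ Q' ∈ gaussianBall μx Sx ρx μw Sw ρw, mse H f Q = mse H f Q' := by
  obtain ⟨-, A, b, hfA⟩ := hf
  obtain ⟨Px, Pw, rfl, hx, hw, hx', hw'⟩ := hQ
  obtain ⟨Cx, hCx⟩ := exists_feas hx hSx hρx hx'
  obtain ⟨Cw, hCw⟩ := exists_feas hw hSw hρw hw'
  refine ⟨_, mem_gaussianBall_of_feas hρx hρw hCx hCw, ?_⟩
  rw [mse_affine H A b hfA hx hw, mse_affine H A b hfA (P2_of_isGaussian _) (P2_of_isGaussian _),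
    covMat_multivariateGaussian _ hCx.posSemidef, covMat_multivariateGaussian _ hCw.posSemidef,
    meanVec_multivariateGaussian, meanVec_multivariateGaussian, add_sub_cancel, add_sub_cancel]

/-- Linear estimators are optimal under normal distributions. -/
lemma exists_linearEstimator_mse_le (H : Matrix (Fin m) (Fin n) ℝ) (Px : Measure (Vec n))
    (Pw : Measure (Vec m)) [IsGaussian Px] [IsGaussian Pw] :
    ∃ f ∈ linearEstimators n m, ∀ g ∈ estimators n m,
      mse H f (Px.prod Pw) ≤ mse H g (Px.prod Pw) := by
  let L : Vec n × Vec m →L[ℝ] Vec n × Vec m :=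
    (ContinuousLinearMap.fst ℝ _ _).prod
      ((LinearMap.toContinuousLinearMap H.toEuclideanLin).comp (ContinuousLinearMap.fst ℝ _ _)
        + ContinuousLinearMap.snd ℝ _ _)
  have hlaw : HasGaussianLaw (fun z : Vec n × Vec m => (z.1, H.toEuclideanLin z.1 + z.2))
      (Px.prod Pw) :=
    (IsGaussian.hasGaussianLaw_id (μ := Px.prod Pw)).map_fun L
  obtain ⟨A, c, h⟩ := exists_affine_optimal measurable_fst
    (by fun_prop : Measurable fun z : Vec n × Vec m => H.toEuclideanLin z.1 + z.2) hlaw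
  have hm : Measurable fun y : Vec m => A.toEuclideanLin y + c := by fun_prop
  exact ⟨_, ⟨hm, A, c, fun y => rfl⟩, fun g hg => h g hg⟩

lemma isSaddleSolution_of_linear (hSx : Sx.PosSemidef) (hSw : Sw.PosSemidef) (hρx : 0 ≤ ρx)
    (hρw : 0 ≤ ρw) {f : Vec m → Vec n} {P : Measure (Vec n × Vec m)}
    (h : IsSaddleSolution (linearEstimators n m) (gaussianBall μx Sx ρx μw Sw ρw) (mse H) f P) :
    IsSaddleSolution (estimators n m) (ball μx Sx ρx μw Sw ρw) (mse H) f P := by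
  obtain ⟨hf, hP, hmax, hmin⟩ := h
  refine ⟨hf.1, gaussianBall_subset_ball hP, fun Q hQ => ?_, fun g hg => ?_⟩
  · obtain ⟨Q', hQ', e⟩ := exists_gaussianBall_mse_eq (H := H) hSx hSw hρx hρw hf hQ
    exact e.trans_le (hmax Q' hQ')
  · obtain ⟨Px, Pw, rfl, -, -, -, -, ⟨_, _, -, rfl⟩, ⟨_, _, -, rfl⟩⟩ := hP
    obtain ⟨f', hf', h'⟩ := exists_linearEstimator_mse_le H (multivariateGaussian _ _)
      (multivariateGaussian _ _)
    exact (hmin f' hf').trans (h' g hg)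

lemma IsSaddleSolution.exists_linear (hSx : Sx.PosSemidef) (hSw : Sw.PosSemidef) (hρx : 0 < ρx)
    (hρw : 0 < ρw) {f : Vec m → Vec n} {P : Measure (Vec n × Vec m)}
    (h : IsSaddleSolution (estimators n m) (ball μx Sx ρx μw Sw ρw) (mse H) f P) :
    ∃ f ∈ linearEstimators n m, ∃ P ∈ gaussianBall μx Sx ρx μw Sw ρw,
      IsSaddleSolution (estimators n m) (ball μx Sx ρx μw Sw ρw) (mse H) f P ∧
      IsSaddleSolution (linearEstimators n m) (gaussianBall μx Sx ρx μw Sw ρw) (mse H) f P := by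
  obtain ⟨hf, ⟨Px, Pw, rfl, hPx, hPw, hWx, hWw⟩, hmax, hmin⟩ := h
  obtain ⟨Cx, hCx⟩ := exists_feas hPx hSx hρx.le hWx
  obtain ⟨Cw, hCw⟩ := exists_feas hPw hSw hρw.le hWw
  -- Moving the mean back to the nominal one only frees budget.
  have hFx : Feas Sx (ρx ^ 2) 0 (covMat Px) Cx :=
    hCx.centered.mono (by linarith [sq_nonneg ‖meanVec Px - μx‖])
  have hFw : Feas Sw (ρw ^ 2) 0 (covMat Pw) Cw :=
    hCw.centered.mono (by linarith [sq_nonneg ‖meanVec Pw - μw‖])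
  have hle : ∀ A : Matrix (Fin n) (Fin m) ℝ, mse H f (Px.prod Pw)
      ≤ ENNReal.ofReal (quad (A * H - 1) (covMat Px) + quad A (covMat Pw)) := by
    intro A
    -- This offset removes the bias under `Px.prod Pw`, so optimality of `f` there bounds `v` by the
    -- pure covariance terms.
    set c := -((A * H - 1).toEuclideanLin (meanVec Px) + A.toEuclideanLin (meanVec Pw)) with hc
    have hm : Measurable fun y : Vec m => A.toEuclideanLin y + c := by fun_prop
    have := hmin _ hm
    rw [mse_affine H A c (fun y => rfl) hPx hPw, hc, add_neg_cancel] at this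
    simpa using this
  obtain ⟨v, hv, hPv⟩ : ∃ v : ℝ, 0 ≤ v ∧ mse H f (Px.prod Pw) = ENNReal.ofReal v :=
    ⟨_, ENNReal.toReal_nonneg,
      (ENNReal.ofReal_toReal ((hle 0).trans_lt ENNReal.ofReal_lt_top).ne).symm⟩
  have hball : ∀ Qx Qw, Near (multivariateGaussian μx Sx) (ρx ^ 2) Qx →
      Near (multivariateGaussian μw Sw) (ρw ^ 2) Qw → mse H f (Qx.prod Qw) ≤ ENNReal.ofReal v :=
    fun Qx Qw hx hw => (hmax _ (mem_ball_of_near hρx.le hρw.le hx hw)).trans_eq hPv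
  have hJ : ∀ A : Matrix (Fin n) (Fin m) ℝ,
      v ≤ quad (A * H - 1) (covMat Px) + quad A (covMat Pw) := fun A =>
    (ENNReal.ofReal_le_ofReal_iff (add_nonneg (quad_nonneg _ hFx.posSemidef)
      (quad_nonneg _ hFw.posSemidef))).1 (hPv ▸ hle A)
  have hGv : ∀ g ∈ estimators n m, ENNReal.ofReal v
      ≤ mse H g ((multivariateGaussian (μx + 0) (covMat Px)).prod
        (multivariateGaussian (μw + 0) (covMat Pw))) := by
    intro g hg
    obtain ⟨A, hA⟩ := exists_le_mse H hg (μx + 0) hFx.posSemidef (μw + 0) hFw.posSemidef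
    exact (ENNReal.ofReal_le_ofReal (hJ A)).trans hA
  -- The centred normal product lies in the ball, so `f` has error at most `v` there. Some `A₀` does
  -- no worse, and with `hJ` it attains exactly `v`.
  obtain ⟨A₀, hA₀⟩ := exists_le_mse H hf (μx + 0) hFx.posSemidef (μw + 0) hFw.posSemidef
  have hA₀' := (ENNReal.ofReal_le_ofReal_iff hv).1
    (hA₀.trans (hball _ _ (hFx.near μx) (hFw.near μw)))
  obtain ⟨A, hA⟩ := exists_forall_affineError_le hf hv hball hSx hSw (by positivity) (by positivity)
    hFx hFw hJ hA₀'
  set c := -((A * H - 1).toEuclideanLin μx + A.toEuclideanLin μw) with hc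
  have hm : Measurable fun y : Vec m => A.toEuclideanLin y + c := by fun_prop
  have hlin : (fun y : Vec m => A.toEuclideanLin y + c) ∈ linearEstimators n m :=
    ⟨hm, A, c, fun y => rfl⟩
  have hub : ∀ Q ∈ ball μx Sx ρx μw Sw ρw,
      mse H (fun y => A.toEuclideanLin y + c) Q ≤ ENNReal.ofReal v := by
    rintro _ ⟨Qx, Qw, rfl, hQx, hQw, hQx', hQw'⟩
    obtain ⟨Ux, hUx⟩ := exists_feas hQx hSx hρx.le hQx'
    obtain ⟨Uw, hUw⟩ := exists_feas hQw hSw hρw.le hQw'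
    rw [mse_affine H A c (fun y => rfl) hQx hQw]
    refine ENNReal.ofReal_le_ofReal ((le_of_eq ?_).trans (hA _ _ _ _ _ _ hUx hUw))
    have e : (A * H - 1).toEuclideanLin (meanVec Qx) + A.toEuclideanLin (meanVec Qw) + c
        = (A * H - 1).toEuclideanLin (meanVec Qx - μx) + A.toEuclideanLin (meanVec Qw - μw) := by
      rw [hc, LinearMap.map_sub, LinearMap.map_sub]
      abel
    rw [affineError, e]
  have hG := mem_gaussianBall_of_feas (μx := μx) (μw := μw) hρx.le hρw.le hFx hFw
  have hG' := gaussianBall_subset_ball hG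
  exact ⟨_, hlin, _, hG,
    ⟨hm, hG', fun Q hQ => (hub Q hQ).trans (hGv _ hm), fun g hg => (hub _ hG').trans (hGv g hg)⟩,
    ⟨hlin, hG, fun Q hQ => (hub Q (gaussianBall_subset_ball hQ)).trans (hGv _ hm),
      fun g hg => (hub _ hG').trans (hGv g hg.1)⟩⟩

end

end

end WDRE


theorem theorem1 (n m : ℕ) (H : Matrix (Fin m) (Fin n) ℝ)
    (μx : WDRE.Vec n) (Sx : Matrix (Fin n) (Fin n) ℝ) (ρx : ℝ)
    (μw : WDRE.Vec m) (Sw : Matrix (Fin m) (Fin m) ℝ) (ρw : ℝ)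
    (hρx : 0 < ρx) (hρw : 0 < ρw) (hSx : Sx.PosSemidef) (hSw : Sw.PosSemidef) :
    ((∃ f P, WDRE.IsSaddleSolution (WDRE.estimators n m)
          (WDRE.ball μx Sx ρx μw Sw ρw) (WDRE.mse H) f P) ↔
      (∃ f P, WDRE.IsSaddleSolution (WDRE.linearEstimators n m)
          (WDRE.gaussianBall μx Sx ρx μw Sw ρw) (WDRE.mse H) f P)) ∧
    ((∃ f P, WDRE.IsSaddleSolution (WDRE.estimators n m)
          (WDRE.ball μx Sx ρx μw Sw ρw) (WDRE.mse H) f P) →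
      ∃ f ∈ WDRE.linearEstimators n m, ∃ P ∈ WDRE.gaussianBall μx Sx ρx μw Sw ρw,
        WDRE.IsSaddleSolution (WDRE.estimators n m)
          (WDRE.ball μx Sx ρx μw Sw ρw) (WDRE.mse H) f P ∧
        WDRE.IsSaddleSolution (WDRE.linearEstimators n m)
          (WDRE.gaussianBall μx Sx ρx μw Sw ρw) (WDRE.mse H) f P) := by
  refine ⟨⟨fun ⟨f, P, h⟩ => ?_, fun ⟨f, P, h⟩ => ?_⟩, fun ⟨f, P, h⟩ => ?_⟩
  · obtain ⟨g, -, Q, -, -, h'⟩ := h.exists_linear hSx hSw hρx hρw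
    exact ⟨g, Q, h'⟩
  · exact ⟨f, P, WDRE.isSaddleSolution_of_linear hSx hSw hρx.le hρw.le h⟩
  · exact h.exists_linear hSx hSw hρx hρw
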